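/- For $x\in(0,1]$ let $d_1(x)=\lfloor 1/x\rfloor+1$, i.e. $d_1(x)\ge 2$ is the integer with $\frac1{d_1(x)}<x\le\frac1{d_1(x)-1}$. Let $\mathscr L:[0,1]\to[0,1]$ be the Lüroth map, $\mathscr L(x)=d_1(x)(d_1(x)-1)x-(d_1(x)-1)$ for $x\in(0,1]$ and $\mathscr L(0)=0$, and let $d_n(x)=d_1(\mathscr L^{n-1}(x))$, $n\ge1$, be the Lüroth digits of $x\in(0,1]$. Let $t_0,t_1>0$ be real numbers. For $B>1$ define \[ \mathcal E_{(t_0,t_1)}(B)=\left\{x\in(0,1]:\ d_n(x)^{t_0}\,d_{n+1}(x)^{t_1}\ge B^n\ \text{ for infinitely many } n\in\mathbb N\right\}, \] and for $s\ge 0$ put \[ f_{t_0,t_1}(s)=\frac{s^2}{t_0t_1\max\left\{\frac{s}{t_1}+\frac{1-s}{t_0},\ \frac{s}{t_0}\right\}} . \] Then for every $B>1$ the equation \[ \sum_{d=2}^{\infty}\frac{1}{d^s(d-1)^s\,B^{f_{t_0,t_1}(s)}}=1 \] has exactly one solution $s=s_0(B)$ in $[0,\infty)$, and the Hausdorff dimension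 of $\mathcal E_{(t_0,t_1)}(B)$ equals $s_0(B)$. Moreover, the map $B\mapsto s_0(B)$ is continuous on $(1,\infty)$. -/

import Mathlib

open Set

noncomputable section

/-- The first Lüroth digit `d₁(x) = ⌊1/x⌋ + 1` of `x ∈ (0,1]`, i.e. the natural number `d ≥ 2` with
`1/d < x ≤ 1/(d-1)`. -/
def lurothFirstDigit (x : ℝ) : ℕ := ⌊1 / x⌋₊ + 1

/-- The Lüroth map: `x ↦ d₁(x)(d₁(x)-1)x - (d₁(x)-1)` for `x ∈ (0,1]`, and `0 ↦ 0`. It is only ever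
used on `[0,1]`. -/
def lurothMap (x : ℝ) : ℝ :=
  if 0 < x then
    (lurothFirstDigit x : ℝ) * ((lurothFirstDigit x : ℝ) - 1) * x - ((lurothFirstDigit x : ℝ) - 1)
  else 0

/-- The `n`-th Lüroth digit, `n ≥ 1`: the first digit of the `(n-1)`-st iterate of the Lüroth map
at `x`. -/
def lurothDigit (n : ℕ) (x : ℝ) : ℕ := lurothFirstDigit (lurothMap^[n - 1] x)

/-- The set of `x ∈ (0,1]` such that `d_n(x)^{t₀} d_{n+1}(x)^{t₁} ≥ Bⁿ` for infinitely many
`n ≥ 1`. -/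
def lurothProductSet (t₀ t₁ B : ℝ) : Set ℝ :=
  {x | x ∈ Ioc (0 : ℝ) 1 ∧
    {n : ℕ | 1 ≤ n ∧
      B ^ n ≤ (lurothDigit n x : ℝ) ^ t₀ * (lurothDigit (n + 1) x : ℝ) ^ t₁}.Infinite}

/-- The exponent function `f_{t₀,t₁}(s)`. For `t₀, t₁ > 0` and `s ≥ 0` its denominator is positive. -/
def lurothExponent (t₀ t₁ s : ℝ) : ℝ :=
  s ^ 2 / (t₀ * t₁ * max (s / t₁ + (1 - s) / t₀) (s / t₀))

/-- `s ≥ 0` solves `∑_{d ≥ 2} 1 / (d^s (d-1)^s B^{f_{t₀,t₁}(s)}) = 1` (convergence included).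
The index `k` stands for `d = k + 2`. -/
def IsLurothRoot (t₀ t₁ B s : ℝ) : Prop :=
  0 ≤ s ∧
    HasSum (fun k : ℕ =>
      1 / (((k : ℝ) + 2) ^ s * ((k : ℝ) + 1) ^ s * B ^ lurothExponent t₀ t₁ s)) 1

end

open Filter Topology MeasureTheory Metric
open scoped ENNReal NNReal

/-! Write ζ for `lurothZeta` and f for `lurothExponent t₀ t₁`. A cylinder with digits d₁, …, dₙ has
length ∏ 1/(dᵢ(dᵢ-1)), so n unrestricted digits contribute ζ(s)^n to an s-dimensional covering sum,
while forcing d_n^t₀ d_{n+1}^t₁ ≥ B^n contributes about B^(-n f(s)). The dimension is the balance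
point ζ(s) = B^f(s). On (1/2, 1] ζ falls strictly from ∞ to 1 and f is positive and nondecreasing,
whence existence, uniqueness and continuity of the root.

If ζ(s) < B^f(s), the set is a limsup of preimages of two-digit conditions.
`hasCountableCover_lurothProduct` covers the n-th condition at cost O(n B^(-n f(s))), each preimage
multiplies the cost by ζ(s) (`HasCountableCover.preimage_lurothMap`), and the costs are summable, so
the Hausdorff measure vanishes (`dimH_lurothProductSet_le`).

If ζ(s) > B^f(s) = θ, some finite partial sum S of ζ(s) still exceeds θ. Choose digits
independently: free ones with weights (d(d-1))^(-s)/S and, infinitely often, a pair of uniform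
digits of sizes about α^n and β^n with α^t₀ β^t₁ = B (`exists_growth_rates`).
`exists_lurothSchedule` spaces the pairs so that cylinder masses stay bounded by a constant times
length^s, and `le_dimH_image_lurothPoint` is the mass distribution principle for such measures
(`le_dimH_lurothProductSet`). -/

/-! ### The pressure series. -/

/-- The term of index `k` (digit `k + 2`) of the pressure series `∑ (d (d - 1))^{-s}`. -/
noncomputable def lurothTerm (s : ℝ) (k : ℕ) : ℝ := 1 / (((k : ℝ) + 2) ^ s * ((k : ℝ) + 1) ^ s)

/-- The pressure series `∑_{d ≥ 2} (d (d - 1))^{-s}`. -/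
noncomputable def lurothZeta (s : ℝ) : ℝ := ∑' k, lurothTerm s k

lemma lurothTerm_pos (s : ℝ) (k : ℕ) : 0 < lurothTerm s k := by
  unfold lurothTerm; positivity

lemma lurothTerm_eq_rpow (s : ℝ) (k : ℕ) :
    lurothTerm s k = (((k : ℝ) + 2) * ((k : ℝ) + 1)) ^ (-s) := by
  rw [lurothTerm, Real.rpow_neg (by positivity), Real.mul_rpow (by positivity) (by positivity),
    one_div]

lemma lurothTerm_strictAnti {s t : ℝ} (h : s < t) (k : ℕ) : lurothTerm t k < lurothTerm s k := by
  rw [lurothTerm_eq_rpow, lurothTerm_eq_rpow]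
  apply Real.rpow_lt_rpow_of_exponent_lt _ (by linarith)
  have : (0 : ℝ) ≤ k := k.cast_nonneg
  nlinarith

lemma continuous_lurothTerm (k : ℕ) : Continuous fun s => lurothTerm s k := by
  simp_rw [lurothTerm_eq_rpow]
  exact continuous_const.rpow continuous_neg fun s => Or.inl (by positivity)

lemma summable_lurothTerm {s : ℝ} (hs : 1 / 2 < s) : Summable (lurothTerm s) := by
  have h : Summable fun k : ℕ => 1 / ((k + 1 : ℕ) : ℝ) ^ (2 * s) :=
    (summable_nat_add_iff 1).2 (Real.summable_one_div_nat_rpow.2 (by linarith))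
  refine h.of_nonneg_of_le (fun k => (lurothTerm_pos s k).le) fun k => ?_
  rw [lurothTerm]
  apply one_div_le_one_div_of_le (by positivity)
  push_cast
  rw [two_mul, Real.rpow_add (by positivity)]
  gcongr
  norm_num

lemma not_summable_lurothTerm {s : ℝ} (hs : s ≤ 1 / 2) : ¬ Summable (lurothTerm s) := by
  intro h
  have h' : Summable fun k : ℕ => 1 / ((k + 2 : ℕ) : ℝ) := by
    refine h.of_nonneg_of_le (fun k => by positivity) fun k => ?_
    rw [lurothTerm_eq_rpow, one_div, ← Real.rpow_neg_one]
    push_cast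
    have h0 : (0 : ℝ) ≤ k := k.cast_nonneg
    calc ((k : ℝ) + 2) ^ (-1 : ℝ) = (((k : ℝ) + 2) ^ (2 : ℝ)) ^ (-(1 / 2) : ℝ) := by
          rw [← Real.rpow_mul (by positivity)]; norm_num
      _ ≤ (((k : ℝ) + 2) * ((k : ℝ) + 1)) ^ (-(1 / 2) : ℝ) := by
          apply Real.rpow_le_rpow_of_nonpos (by positivity) _ (by norm_num)
          rw [Real.rpow_two]
          nlinarith
      _ ≤ _ := by
          apply Real.rpow_le_rpow_of_exponent_le _ (by linarith)
          nlinarith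
  exact Real.not_summable_one_div_natCast ((summable_nat_add_iff 2).1 h')

lemma lurothZeta_strictAnti {s t : ℝ} (hs : 1 / 2 < s) (h : s < t) :
    lurothZeta t < lurothZeta s :=
  (summable_lurothTerm (hs.trans h)).tsum_lt_tsum (i := 0)
    (fun k => (lurothTerm_strictAnti h k).le) (lurothTerm_strictAnti h 0) (summable_lurothTerm hs)

/-- The series telescopes: 1/((k+1)(k+2)) = 1/(k+1) - 1/(k+2). -/
lemma hasSum_lurothTerm_one : HasSum (lurothTerm 1) 1 := by
  have h : Tendsto (fun n : ℕ => 1 - 1 / ((n : ℝ) + 1)) atTop (𝓝 (1 - 0)) :=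
    tendsto_const_nhds.sub tendsto_one_div_add_atTop_nhds_zero_nat
  rw [sub_zero] at h
  rw [hasSum_iff_tendsto_nat_of_nonneg fun k => (lurothTerm_pos 1 k).le]
  refine h.congr fun n => ?_
  induction n with
  | zero => simp
  | succ n ih =>
    rw [Finset.sum_range_succ, ← ih, lurothTerm, Real.rpow_one, Real.rpow_one]
    push_cast
    field_simp
    ring

lemma lurothZeta_one : lurothZeta 1 = 1 := hasSum_lurothTerm_one.tsum_eq

lemma lurothZeta_pos {s : ℝ} (hs : 1 / 2 < s) : 0 < lurothZeta s :=
  (summable_lurothTerm hs).tsum_pos (fun k => (lurothTerm_pos s k).le) 0 (lurothTerm_pos s 0)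

lemma continuousOn_lurothZeta {a : ℝ} (ha : 1 / 2 < a) : ContinuousOn lurothZeta (Ici a) := by
  refine continuousOn_tsum (fun k => (continuous_lurothTerm k).continuousOn)
    (summable_lurothTerm ha) fun k s hs => ?_
  rw [Real.norm_of_nonneg (lurothTerm_pos s k).le]
  rcases eq_or_lt_of_le (show a ≤ s from hs) with rfl | h
  · exact le_rfl
  · exact (lurothTerm_strictAnti h k).le

/-- The series blows up at 1/2 from the right: some partial sum at 1/2 already exceeds `c`, and
finite sums are continuous in s. -/
lemma exists_lt_lurothZeta (c : ℝ) : ∃ a, 1 / 2 < a ∧ a < 1 ∧ c < lurothZeta a := by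
  have h1 : Tendsto (fun n => ∑ k ∈ Finset.range n, lurothTerm (1 / 2) k) atTop atTop :=
    (not_summable_iff_tendsto_nat_atTop_of_nonneg fun k => (lurothTerm_pos _ k).le).1
      (not_summable_lurothTerm le_rfl)
  obtain ⟨n, hn⟩ := (h1.eventually_gt_atTop c).exists
  have h2 : Continuous fun s => ∑ k ∈ Finset.range n, lurothTerm s k :=
    continuous_finsetSum _ fun k _ => continuous_lurothTerm k
  have h3 : ∀ᶠ s in 𝓝[>] (1 / 2 : ℝ), c < ∑ k ∈ Finset.range n, lurothTerm s k :=
    nhdsWithin_le_nhds (h2.continuousAt.eventually_const_lt hn)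
  obtain ⟨a, ⟨ha, ha1⟩, hc⟩ :=
    (Filter.Eventually.and (Ioo_mem_nhdsGT (show (1 / 2 : ℝ) < 1 by norm_num)) h3).exists
  exact ⟨a, ha, ha1, hc.trans_le
    ((summable_lurothTerm ha).sum_le_tsum _ fun k _ => (lurothTerm_pos a k).le)⟩

/-! ### The exponent function. -/

section Exponent

variable {t₀ t₁ : ℝ}

lemma lurothExponent_denom_eq (ht₀ : 0 < t₀) (ht₁ : 0 < t₁) (s : ℝ) :
    t₀ * t₁ * max (s / t₁ + (1 - s) / t₀) (s / t₀) = max (t₀ * s + t₁ * (1 - s)) (t₁ * s) := by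
  rw [mul_max_of_nonneg _ _ (by positivity)]
  congr 1 <;> field_simp

lemma lurothExponent_eq (ht₀ : 0 < t₀) (ht₁ : 0 < t₁) (s : ℝ) :
    lurothExponent t₀ t₁ s = s ^ 2 / max (t₀ * s + t₁ * (1 - s)) (t₁ * s) := by
  rw [lurothExponent, lurothExponent_denom_eq ht₀ ht₁]

lemma lurothExponent_pos (ht₀ : 0 < t₀) (ht₁ : 0 < t₁) {s : ℝ} (hs : 0 < s) :
    0 < lurothExponent t₀ t₁ s := by
  rw [lurothExponent_eq ht₀ ht₁]
  have : 0 < t₁ * s := by positivity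
  have := lt_max_of_lt_right (b := t₀ * s + t₁ * (1 - s)) this
  positivity

/-- After cross-multiplication it suffices to bound the maximum at `s` below by the entry that
realises the maximum at `t`; the difference is then (t - s) times a nonnegative polynomial. -/
lemma lurothExponent_mono (ht₀ : 0 < t₀) (ht₁ : 0 < t₁) {s t : ℝ} (hs : 0 < s) (hst : s ≤ t)
    (ht : t ≤ 1) : lurothExponent t₀ t₁ s ≤ lurothExponent t₀ t₁ t := by
  rw [lurothExponent_eq ht₀ ht₁, lurothExponent_eq ht₀ ht₁]
  have h1 : 0 < t₁ * s := by positivity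
  have h2 : 0 < t := hs.trans_le hst
  have h3 : 0 < t₁ * t := by positivity
  have h4 := le_max_left (t₀ * s + t₁ * (1 - s)) (t₁ * s)
  have h5 := le_max_right (t₀ * s + t₁ * (1 - s)) (t₁ * s)
  rw [div_le_div_iff₀ (lt_max_of_lt_right h1) (lt_max_of_lt_right h3)]
  have h6 : 0 ≤ t - s := by linarith
  have h7 : 0 ≤ 1 - t := by linarith
  rcases max_cases (t₀ * t + t₁ * (1 - t)) (t₁ * t) with ⟨h, -⟩ | ⟨h, -⟩
  · rw [h]
    refine le_trans ?_ (mul_le_mul_of_nonneg_left h4 (by positivity))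
    have e : t ^ 2 * (t₀ * s + t₁ * (1 - s)) - s ^ 2 * (t₀ * t + t₁ * (1 - t))
      = (t - s) * (t₀ * (s * t) + t₁ * (t * (1 - s) + s * (1 - t)) + t₁ * (s * t) ) := by ring
    have h8 : 0 ≤ 1 - s := by linarith
    have : 0 ≤ (t - s) * (t₀ * (s * t) + t₁ * (t * (1 - s) + s * (1 - t)) + t₁ * (s * t) ) := by
      positivity
    linarith
  · rw [h]
    refine le_trans ?_ (mul_le_mul_of_nonneg_left h5 (by positivity))
    have : s ^ 2 * (t₁ * t) = t₁ * s * t * s := by ring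
    have : t ^ 2 * (t₁ * s) = t₁ * s * t * t := by ring
    have : t₁ * s * t * s ≤ t₁ * s * t * t := by gcongr
    linarith

lemma continuousOn_lurothExponent (ht₀ : 0 < t₀) (ht₁ : 0 < t₁) :
    ContinuousOn (lurothExponent t₀ t₁) (Ioi 0) := by
  simp_rw [funext (lurothExponent_eq ht₀ ht₁)]
  refine ContinuousOn.div (by fun_prop) (by fun_prop) fun s hs => ?_
  have : 0 < t₁ * s := mul_pos ht₁ hs
  exact (lt_max_of_lt_right this).ne'

end Exponent

/-! ### Existence, uniqueness and continuity of the root. -/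

section Root

variable {t₀ t₁ B : ℝ}

/-- Convergence is part of being a root, which forces s > 1/2; beyond that the constant factor comes
out of the sum. -/
lemma isLurothRoot_iff (hB : 1 < B) {s : ℝ} :
    IsLurothRoot t₀ t₁ B s ↔ 1 / 2 < s ∧ lurothZeta s = B ^ lurothExponent t₀ t₁ s := by
  have hE : (0 : ℝ) < B ^ lurothExponent t₀ t₁ s := Real.rpow_pos_of_pos (by linarith) _
  have h1 : (fun k : ℕ =>
      1 / (((k : ℝ) + 2) ^ s * ((k : ℝ) + 1) ^ s * B ^ lurothExponent t₀ t₁ s)) =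
      fun k => lurothTerm s k / B ^ lurothExponent t₀ t₁ s := by
    ext k; rw [lurothTerm, div_div]
  rw [IsLurothRoot, h1]
  constructor
  · rintro ⟨-, h⟩
    have h2 := h.mul_right (B ^ lurothExponent t₀ t₁ s)
    simp only [div_mul_cancel₀ _ hE.ne', one_mul] at h2
    refine ⟨?_, h2.tsum_eq⟩
    by_contra! hs
    exact not_summable_lurothTerm hs h2.summable
  · rintro ⟨hs, h⟩
    refine ⟨by linarith, ?_⟩
    have h2 := (summable_lurothTerm hs).hasSum.div_const (B ^ lurothExponent t₀ t₁ s)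
    rwa [← lurothZeta, h, div_self hE.ne'] at h2

lemma exists_isLurothRoot (ht₀ : 0 < t₀) (ht₁ : 0 < t₁) (hB : 1 < B) :
    ∃ s, IsLurothRoot t₀ t₁ B s := by
  obtain ⟨a, ha, ha1, hc⟩ := exists_lt_lurothZeta (B ^ lurothExponent t₀ t₁ 1)
  have hcont : ContinuousOn (fun s => lurothZeta s - B ^ lurothExponent t₀ t₁ s) (Icc a 1) := by
    refine ((continuousOn_lurothZeta ha).mono Icc_subset_Ici_self).sub ?_
    refine ContinuousOn.rpow continuousOn_const ((continuousOn_lurothExponent ht₀ ht₁).mono ?_) ?_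
    · intro s hs; simp only [mem_Ioi]; linarith [hs.1]
    · intro s _; left; linarith
  have h1 : (0 : ℝ) ∈ Icc (lurothZeta 1 - B ^ lurothExponent t₀ t₁ 1)
      (lurothZeta a - B ^ lurothExponent t₀ t₁ a) := by
    constructor
    · rw [lurothZeta_one]
      have := Real.one_lt_rpow hB (lurothExponent_pos ht₀ ht₁ one_pos)
      linarith
    · have := Real.rpow_le_rpow_of_exponent_le hB.le
        (lurothExponent_mono ht₀ ht₁ (s := a) (by linarith) ha1.le le_rfl)
      linarith
  obtain ⟨s, hs, h⟩ := intermediate_value_Icc' ha1.le hcont h1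
  exact ⟨s, (isLurothRoot_iff hB).2 ⟨ha.trans_le hs.1, sub_eq_zero.1 h⟩⟩

lemma IsLurothRoot.half_lt (hB : 1 < B) {s : ℝ} (h : IsLurothRoot t₀ t₁ B s) : 1 / 2 < s :=
  ((isLurothRoot_iff hB).1 h).1

lemma IsLurothRoot.lt_one (ht₀ : 0 < t₀) (ht₁ : 0 < t₁) (hB : 1 < B) {s : ℝ}
    (h : IsLurothRoot t₀ t₁ B s) : s < 1 := by
  obtain ⟨hs, h⟩ := (isLurothRoot_iff hB).1 h
  by_contra! h1
  have h2 : lurothZeta s ≤ 1 := by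
    rcases h1.eq_or_lt with rfl | h1
    · exact lurothZeta_one.le
    · exact (lurothZeta_strictAnti (by norm_num) h1).le.trans lurothZeta_one.le
  have := Real.one_lt_rpow hB (lurothExponent_pos ht₀ ht₁ (show 0 < s by linarith))
  linarith

lemma IsLurothRoot.rpow_lt_lurothZeta (ht₀ : 0 < t₀) (ht₁ : 0 < t₁) (hB : 1 < B) {s a : ℝ}
    (h : IsLurothRoot t₀ t₁ B s) (ha : 1 / 2 < a) (has : a < s) :
    B ^ lurothExponent t₀ t₁ a < lurothZeta a := by
  calc _ ≤ B ^ lurothExponent t₀ t₁ s := Real.rpow_le_rpow_of_exponent_le hB.le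
        (lurothExponent_mono ht₀ ht₁ (by linarith) has.le (h.lt_one ht₀ ht₁ hB).le)
    _ = lurothZeta s := ((isLurothRoot_iff hB).1 h).2.symm
    _ < _ := lurothZeta_strictAnti ha has

lemma IsLurothRoot.lurothZeta_lt_rpow (ht₀ : 0 < t₀) (ht₁ : 0 < t₁) (hB : 1 < B) {s a : ℝ}
    (h : IsLurothRoot t₀ t₁ B s) (hsa : s < a) (ha : a ≤ 1) :
    lurothZeta a < B ^ lurothExponent t₀ t₁ a := by
  have hs := h.half_lt hB
  calc _ < lurothZeta s := lurothZeta_strictAnti hs hsa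
    _ = B ^ lurothExponent t₀ t₁ s := ((isLurothRoot_iff hB).1 h).2
    _ ≤ _ := Real.rpow_le_rpow_of_exponent_le hB.le
        (lurothExponent_mono ht₀ ht₁ (by linarith) hsa.le ha)

lemma IsLurothRoot.unique (ht₀ : 0 < t₀) (ht₁ : 0 < t₁) (hB : 1 < B) {s t : ℝ}
    (h : IsLurothRoot t₀ t₁ B s) (h' : IsLurothRoot t₀ t₁ B t) : s = t := by
  have hs := (isLurothRoot_iff hB).1 h
  have ht := (isLurothRoot_iff hB).1 h'
  rcases lt_trichotomy s t with hst | hst | hst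
  · exact absurd hs.2 (h'.rpow_lt_lurothZeta ht₀ ht₁ hB hs.1 hst).ne'
  · exact hst
  · exact absurd ht.2 (h.rpow_lt_lurothZeta ht₀ ht₁ hB ht.1 hst).ne'

lemma continuousOn_of_isLurothRoot (ht₀ : 0 < t₀) (ht₁ : 0 < t₁) {s₀ : ℝ → ℝ}
    (h : ∀ B, 1 < B → IsLurothRoot t₀ t₁ B (s₀ B)) : ContinuousOn s₀ (Ioi 1) := by
  intro B hB
  have hB' : (1 : ℝ) < B := hB
  have hpow (a : ℝ) : Tendsto (fun B : ℝ => B ^ lurothExponent t₀ t₁ a) (𝓝[Ioi 1] B)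
      (𝓝 (B ^ lurothExponent t₀ t₁ a)) :=
    (Real.continuousAt_rpow_const B _ (Or.inl (by linarith))).tendsto.mono_left nhdsWithin_le_nhds
  have hmem : ∀ᶠ b in 𝓝[Ioi 1] B, 1 < b := self_mem_nhdsWithin
  -- Strict inequality between `lurothZeta a` and B^f(a) persists for b near B, and its direction
  -- tells on which side of a the root for b lies.
  refine tendsto_order.2 ⟨fun a ha => ?_, fun a ha => ?_⟩
  · rcases le_or_gt a (1 / 2) with ha2 | ha2
    · filter_upwards [hmem] with b hb
      exact ha2.trans_lt ((h b hb).half_lt hb)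
    · filter_upwards [hmem, (hpow a).eventually_lt_const
        ((h B hB).rpow_lt_lurothZeta ht₀ ht₁ hB ha2 ha)] with b hb hlt
      by_contra! hle
      rcases hle.eq_or_lt with he | hl
      · have := ((isLurothRoot_iff hb).1 (h b hb)).2
        rw [he] at this
        linarith
      · exact hlt.not_gt ((h b hb).lurothZeta_lt_rpow ht₀ ht₁ hb hl
          (ha.trans ((h B hB).lt_one ht₀ ht₁ hB)).le)
  · rcases le_or_gt 1 a with ha2 | ha2
    · filter_upwards [hmem] with b hb
      exact ((h b hb).lt_one ht₀ ht₁ hb).trans_le ha2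
    · filter_upwards [hmem, (hpow a).eventually_const_lt
        ((h B hB).lurothZeta_lt_rpow ht₀ ht₁ hB ha ha2.le)] with b hb hlt
      by_contra! hle
      rcases hle.eq_or_lt with he | hl
      · have := ((isLurothRoot_iff hb).1 (h b hb)).2
        rw [← he] at this
        linarith
      · exact hlt.not_gt ((h b hb).rpow_lt_lurothZeta ht₀ ht₁ hb
          (((h B hB).half_lt hB).trans ha) hl)

end Root

/-! ### Inverse branches of the Lüroth map. -/

/-- The inverse branch of the Lüroth map onto the interval of points with first digit `d`. -/
noncomputable def lurothBranch (d : ℕ) (y : ℝ) : ℝ := (y + ((d : ℝ) - 1)) / ((d : ℝ) * ((d : ℝ) - 1))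

lemma lurothFirstDigit_branch {d : ℕ} (hd : 2 ≤ d) {y : ℝ} (hy : y ∈ Ioc (0 : ℝ) 1) :
    lurothFirstDigit (lurothBranch d y) = d := by
  have hd' : (2 : ℝ) ≤ d := by exact_mod_cast hd
  have hy0 : 0 < y := hy.1
  have h1 : (0 : ℝ) < (d : ℝ) - 1 := by linarith
  obtain ⟨e, rfl⟩ : ∃ e, d = e + 1 := ⟨d - 1, by omega⟩
  rw [lurothFirstDigit, lurothBranch, Nat.add_right_cancel_iff, one_div_div,
    Nat.floor_eq_iff (by positivity)]
  push_cast at *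
  have he : (1 : ℝ) ≤ e := by linarith
  simp only [add_sub_cancel_right]
  rw [le_div_iff₀ (by linarith), div_lt_iff₀ (by linarith)]
  constructor <;> nlinarith [hy.2]

lemma lurothBranch_pos {d : ℕ} (hd : 2 ≤ d) {y : ℝ} (hy : 0 < y) : 0 < lurothBranch d y := by
  have hd' : (2 : ℝ) ≤ d := by exact_mod_cast hd
  have h1 : (0 : ℝ) < (d : ℝ) - 1 := by linarith
  rw [lurothBranch]; positivity

lemma lurothMap_branch {d : ℕ} (hd : 2 ≤ d) {y : ℝ} (hy : y ∈ Ioc (0 : ℝ) 1) :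
    lurothMap (lurothBranch d y) = y := by
  have hd' : (2 : ℝ) ≤ d := by exact_mod_cast hd
  have h1 : (0 : ℝ) < (d : ℝ) - 1 := by linarith
  rw [lurothMap, if_pos (lurothBranch_pos hd hy.1), lurothFirstDigit_branch hd hy, lurothBranch,
    mul_div_cancel₀ _ (by positivity)]
  ring

lemma two_le_lurothFirstDigit {x : ℝ} (hx : x ∈ Ioc (0 : ℝ) 1) : 2 ≤ lurothFirstDigit x := by
  rw [lurothFirstDigit]
  have : 1 ≤ ⌊1 / x⌋₊ := Nat.le_floor (by
    rw [Nat.cast_one, le_div_iff₀ hx.1]; linarith [hx.2])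
  omega

lemma lurothBranch_lurothMap {x : ℝ} (hx : x ∈ Ioc (0 : ℝ) 1) :
    lurothBranch (lurothFirstDigit x) (lurothMap x) = x := by
  have hd' : (2 : ℝ) ≤ lurothFirstDigit x := by exact_mod_cast two_le_lurothFirstDigit hx
  have h1 : (0 : ℝ) < (lurothFirstDigit x : ℝ) - 1 := by linarith
  rw [lurothMap, if_pos hx.1, lurothBranch, sub_add_cancel, mul_div_cancel_left₀ _ (by positivity)]

lemma lurothMap_mem {x : ℝ} (hx : x ∈ Ioc (0 : ℝ) 1) : lurothMap x ∈ Ioc (0 : ℝ) 1 := by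
  have hd' : (2 : ℝ) ≤ lurothFirstDigit x := by exact_mod_cast two_le_lurothFirstDigit hx
  have h0 : (0 : ℝ) ≤ 1 / x := by have := hx.1; positivity
  have h1 := Nat.floor_le h0
  have h2 := Nat.lt_floor_add_one (1 / x)
  have h3 : (lurothFirstDigit x : ℝ) = (⌊1 / x⌋₊ : ℝ) + 1 := by simp [lurothFirstDigit]
  rw [← h3, div_lt_iff₀ hx.1] at h2
  have h4 : ((lurothFirstDigit x : ℝ) - 1) * x ≤ 1 := by
    rw [← le_div_iff₀ hx.1]; linarith
  rw [lurothMap, if_pos hx.1]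
  constructor <;> nlinarith

lemma iterate_lurothMap_mem {x : ℝ} (hx : x ∈ Ioc (0 : ℝ) 1) (n : ℕ) :
    lurothMap^[n] x ∈ Ioc (0 : ℝ) 1 := by
  induction n with
  | zero => exact hx
  | succ n ih => rw [Function.iterate_succ_apply']; exact lurothMap_mem ih

lemma lurothFirstDigit_le {x : ℝ} (hx : x ∈ Ioc (0 : ℝ) 1) : (lurothFirstDigit x : ℝ) ≤ 2 / x := by
  have h0 : (1 : ℝ) ≤ 1 / x := by rw [le_div_iff₀ hx.1]; linarith [hx.2]
  have h1 := Nat.floor_le (zero_le_one.trans h0)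
  rw [lurothFirstDigit]
  push_cast
  calc (⌊1 / x⌋₊ : ℝ) + 1 ≤ 1 / x + 1 / x := by linarith
    _ = 2 / x := by ring

lemma lipschitzWith_lurothBranch {d : ℕ} (hd : 2 ≤ d) :
    LipschitzWith (Real.toNNReal (1 / ((d : ℝ) * ((d : ℝ) - 1)))) (lurothBranch d) := by
  have hd' : (2 : ℝ) ≤ d := by exact_mod_cast hd
  have h1 : (0 : ℝ) < (d : ℝ) - 1 := by linarith
  refine LipschitzWith.of_dist_le_mul fun x y => ?_
  rw [Real.coe_toNNReal _ (by positivity), Real.dist_eq, Real.dist_eq, lurothBranch, lurothBranch,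
    ← sub_div, abs_div, abs_of_pos (show 0 < (d : ℝ) * ((d : ℝ) - 1) by positivity)]
  apply le_of_eq
  ring_nf

/-- Points of two different first-level intervals are separated when either the left one stays away
from the right endpoint of its interval or the right one stays away from the left endpoint. -/
lemma lurothBranch_sub_ge {a b M : ℕ} (ha : 2 ≤ a) (hab : a < b) (hM : 2 ≤ M) {y y' : ℝ}
    (hy : y ∈ Ioc (0 : ℝ) 1) (hy' : y' ∈ Ioc (0 : ℝ) 1) (h : y ≤ 1 / 2 ∨ 1 / (M : ℝ) ≤ y') :
    ((b : ℝ) - a) / (a * b) / M ≤ lurothBranch a y' - lurothBranch b y := by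
  have ha' : (2 : ℝ) ≤ a := by exact_mod_cast ha
  have hM' : (2 : ℝ) ≤ M := by exact_mod_cast hM
  have hab' : (a : ℝ) + 1 ≤ b := by exact_mod_cast hab
  have ha1 : (0 : ℝ) < (a : ℝ) - 1 := by linarith
  have hb1 : (0 : ℝ) < (b : ℝ) - 1 := by linarith
  have ha0 : (0 : ℝ) < a := by linarith
  have hb0 : (0 : ℝ) < b := by linarith
  have hMinv : (M : ℝ)⁻¹ ≤ 1 / 2 := by
    rw [inv_eq_one_div]; exact one_div_le_one_div_of_le (by norm_num) hM'
  have hMpos : (0 : ℝ) < (M : ℝ)⁻¹ := by positivity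
  -- 1/a - 1/b is the distance between left endpoints. For b = a + 1 the two intervals abut, so it
  -- can be entirely used up by the y-term; the hypothesis `h` excludes this.
  have key : lurothBranch a y' - lurothBranch b y
      = ((b : ℝ) - a) / (a * b) + y' / (a * (a - 1)) - y / (b * (b - 1)) := by
    rw [lurothBranch, lurothBranch]
    field_simp
    ring
  rw [key]
  have e1 : ((b : ℝ) - a) / (a * b) / M = (b - a) / (a * b) * (M : ℝ)⁻¹ := div_eq_mul_inv _ _
  rw [e1]
  have hle : 1 / ((b : ℝ) * (b - 1)) ≤ (b - a) / (a * b) := by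
    rw [div_le_div_iff₀ (by positivity) (by positivity)]
    have : (a : ℝ) * b ≤ b * (b - 1) := by nlinarith
    nlinarith [mul_pos hb0 hb1]
  have hy1 := hy.1
  have hy1' := hy'.1
  rcases h with h | h
  · have h1 : y / (b * (b - 1)) ≤ (1 / 2) * ((b - a) / (a * b)) := by
      calc y / ((b : ℝ) * (b - 1)) = y * (1 / (b * (b - 1))) := by ring
        _ ≤ (1 / 2) * ((b - a) / (a * b)) := by
          apply mul_le_mul h hle (by positivity) (by norm_num)
    have h2 : 0 ≤ y' / ((a : ℝ) * (a - 1)) := by positivity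
    have h3 : 0 ≤ ((b : ℝ) - a) / (a * b) := le_trans (by positivity) hle
    nlinarith
  · have h1 : y / ((b : ℝ) * (b - 1)) ≤ 1 / (b * (b - 1)) := by
      gcongr; exact hy.2
    have h2 : (M : ℝ)⁻¹ * (1 / (a * (a - 1))) ≤ y' / ((a : ℝ) * (a - 1)) := by
      rw [one_div] at h
      rw [div_eq_mul_one_div y']
      gcongr
    have h3 : 1 / ((b : ℝ) * (b - 1)) ≤ 1 / (a * (a - 1)) := by
      apply one_div_le_one_div_of_le (by positivity)
      nlinarith
    have h4 : (M : ℝ)⁻¹ * (1 / (b * (b - 1))) ≤ (M : ℝ)⁻¹ * (1 / (a * (a - 1))) := by gcongr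
    nlinarith

/-! ### Covers and the upper bound. -/

/-- `E` has a countable cover by sets of diameter at most `δ` whose `s`-th powers of diameters have
sum at most `c`. -/
def HasCountableCover (s : ℝ) (E : Set ℝ) (δ c : ℝ≥0∞) : Prop :=
  ∃ (ι : Type) (_ : Countable ι) (t : ι → Set ℝ),
    E ⊆ ⋃ i, t i ∧ (∀ i, ediam (t i) ≤ δ) ∧ ∑' i, ediam (t i) ^ s ≤ c

/-- The branch of digit d contracts by 1/(d(d-1)) ≤ 1/2, so pulling a cover back through all
branches halves the mesh and multiplies the cost by ∑ (d(d-1))^(-s). -/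
lemma HasCountableCover.preimage_lurothMap {s : ℝ} (hs : 1 / 2 < s) {E : Set ℝ} {δ c : ℝ≥0∞}
    (h : HasCountableCover s E δ c) :
    HasCountableCover s {x | x ∈ Ioc (0 : ℝ) 1 ∧ lurothMap x ∈ E} (2⁻¹ * δ)
      (ENNReal.ofReal (lurothZeta s) * c) := by
  obtain ⟨ι, hι, t, hE, hδ, hc⟩ := h
  have hdiam (k : ℕ) (i : ι) : ediam (lurothBranch (k + 2) '' t i) ≤
      ENNReal.ofReal (1 / (((k : ℝ) + 2) * ((k : ℝ) + 1))) * ediam (t i) := by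
    have := (lipschitzWith_lurothBranch (show 2 ≤ k + 2 by omega)).ediam_image_le (t i)
    push_cast at this
    rwa [show (k : ℝ) + 2 - 1 = k + 1 by ring] at this
  refine ⟨ℕ × ι, inferInstance, fun p => lurothBranch (p.1 + 2) '' t p.2, ?_, ?_, ?_⟩
  · rintro x ⟨hx, hLx⟩
    obtain ⟨i, hi⟩ := mem_iUnion.1 (hE hLx)
    refine mem_iUnion.2 ⟨(lurothFirstDigit x - 2, i), ?_⟩
    refine ⟨lurothMap x, hi, ?_⟩
    rw [Nat.sub_add_cancel (two_le_lurothFirstDigit hx), lurothBranch_lurothMap hx]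
  · rintro ⟨k, i⟩
    refine (hdiam k i).trans (mul_le_mul' ?_ (hδ i))
    rw [← ENNReal.ofReal_ofNat, ← ENNReal.ofReal_inv_of_pos (by norm_num)]
    apply ENNReal.ofReal_le_ofReal
    rw [← one_div]
    apply one_div_le_one_div_of_le (by norm_num)
    have : (0 : ℝ) ≤ k := k.cast_nonneg
    nlinarith
  · have hs0 : 0 ≤ s := by linarith
    calc ∑' p : ℕ × ι, ediam (lurothBranch (p.1 + 2) '' t p.2) ^ s
        ≤ ∑' p : ℕ × ι, ENNReal.ofReal (lurothTerm s p.1) * ediam (t p.2) ^ s := by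
          refine ENNReal.tsum_le_tsum fun p => ?_
          refine (ENNReal.rpow_le_rpow (hdiam p.1 p.2) hs0).trans_eq ?_
          rw [ENNReal.mul_rpow_of_nonneg _ _ hs0, ENNReal.ofReal_rpow_of_nonneg (by positivity) hs0,
            lurothTerm_eq_rpow, one_div, Real.inv_rpow (by positivity),
            Real.rpow_neg (by positivity)]
      _ = ∑' k, ENNReal.ofReal (lurothTerm s k) * ∑' i, ediam (t i) ^ s := by
          rw [ENNReal.tsum_prod (f := fun k i => ENNReal.ofReal (lurothTerm s k) * ediam (t i) ^ s)]
          simp_rw [ENNReal.tsum_mul_left]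
      _ = ENNReal.ofReal (lurothZeta s) * ∑' i, ediam (t i) ^ s := by
          rw [ENNReal.tsum_mul_right, lurothZeta,
            ENNReal.ofReal_tsum_of_nonneg (fun k => (lurothTerm_pos s k).le)
              (summable_lurothTerm hs)]
      _ ≤ _ := by gcongr

lemma HasCountableCover.preimage_iterate_lurothMap {s : ℝ} (hs : 1 / 2 < s) {E : Set ℝ}
    {δ c : ℝ≥0∞} (h : HasCountableCover s E δ c) (n : ℕ) :
    HasCountableCover s {x | x ∈ Ioc (0 : ℝ) 1 ∧ lurothMap^[n] x ∈ E} (2⁻¹ ^ n * δ)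
      (ENNReal.ofReal (lurothZeta s) ^ n * c) := by
  induction n with
  | zero =>
    obtain ⟨ι, hι, t, hE, hδ, hc⟩ := h
    exact ⟨ι, hι, t, fun x hx => hE hx.2, by simpa using hδ, by simpa using hc⟩
  | succ n ih =>
    have := ih.preimage_lurothMap hs
    rw [← mul_assoc, ← mul_assoc, ← pow_succ', ← pow_succ'] at this
    obtain ⟨ι, hι, t, hE, hδ, hc⟩ := this
    refine ⟨ι, hι, t, fun x hx => hE ⟨hx.1, lurothMap_mem hx.1, ?_⟩, hδ, hc⟩
    rw [← Function.iterate_succ_apply]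
    exact hx.2

/-- If every point of `E` lies in infinitely many of the sets `A n`, which have fine covers with
summable costs, then `E` is null for the Hausdorff measure. -/
lemma hausdorffMeasure_eq_zero_of_hasCountableCover {s : ℝ} {E : Set ℝ} {A : ℕ → Set ℝ}
    {δ c : ℕ → ℝ≥0∞} (hA : ∀ n, HasCountableCover s (A n) (δ n) (c n))
    (hδ : Antitone δ) (hδ0 : Tendsto δ atTop (𝓝 0)) (hc : ∑' n, c n ≠ ∞)
    (hE : ∀ x ∈ E, {n | x ∈ A n}.Infinite) : μH[s] E = 0 := by
  choose ι hι t hcov hdiam hsum using hA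
  have hle := Measure.hausdorffMeasure_le_liminf_tsum (β := ℕ) (ι := fun N => Σ n : ℕ, ι (n + N))
    (l := atTop) s E δ hδ0 (fun N p => t (p.1 + N) p.2)
    (Eventually.of_forall fun N p => (hdiam _ _).trans (hδ (by omega)))
    (Eventually.of_forall fun N x hx => by
      obtain ⟨n, hn, hNn⟩ := (hE x hx).exists_gt N
      obtain ⟨m, rfl⟩ : ∃ m, n = m + N := ⟨n - N, by omega⟩
      obtain ⟨i, hi⟩ := mem_iUnion.1 (hcov _ hn)
      exact mem_iUnion.2 ⟨⟨m, i⟩, hi⟩)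
  refine le_antisymm (hle.trans ?_) bot_le
  refine (liminf_le_liminf (v := fun N => ∑' n, c (n + N)) (Eventually.of_forall fun N => ?_)).trans
    (ENNReal.tendsto_sum_nat_add c hc).liminf_eq.le
  rw [ENNReal.tsum_sigma (f := fun n i => ediam (t (n + N) i) ^ s)]
  exact ENNReal.tsum_le_tsum fun n => hsum _

section

variable {t₀ t₁ B s : ℝ}

/-- These are the inequalities needed at the two extreme sizes of the first digit in
`lurothCover_diam_rpow_le`. -/
lemma lurothExponent_mul_le (ht₀ : 0 < t₀) (ht₁ : 0 < t₁) (hs : 0 < s) :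
    lurothExponent t₀ t₁ s * (t₀ * s + t₁ * (1 - s)) ≤ s ^ 2 ∧
      lurothExponent t₀ t₁ s * t₁ ≤ s := by
  have hf := lurothExponent_pos ht₀ ht₁ hs
  have h1 : 0 < t₁ * s := by positivity
  have h0 := lt_max_of_lt_right (b := t₀ * s + t₁ * (1 - s)) h1
  have h2 : lurothExponent t₀ t₁ s * max (t₀ * s + t₁ * (1 - s)) (t₁ * s) = s ^ 2 := by
    rw [lurothExponent_eq ht₀ ht₁, div_mul_cancel₀ _ h0.ne']
  have h3 := mul_le_mul_of_nonneg_left (le_max_left (t₀ * s + t₁ * (1 - s)) (t₁ * s)) hf.le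
  have h4 := mul_le_mul_of_nonneg_left (le_max_right (t₀ * s + t₁ * (1 - s)) (t₁ * s)) hf.le
  refine ⟨by linarith, ?_⟩
  have : lurothExponent t₀ t₁ s * t₁ * s ≤ s * s := by nlinarith
  exact le_of_mul_le_mul_right this hs

/-- The factor d⁻¹ is what matters: summed over first digits up to the cutoff it yields a harmonic
sum, hence only a factor linear in n. -/
lemma lurothCover_diam_rpow_le (ht₀ : 0 < t₀) (ht₁ : 0 < t₁) (hB : 1 < B) (hs : 1 / 2 < s)
    (hs1 : s ≤ 1) (n : ℕ) {d : ℕ} (hd : 2 ≤ d)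
    (hdX : (d : ℝ) ≤ B ^ (n * (lurothExponent t₀ t₁ s / s))) :
    (1 / ((d : ℝ) * (d - 1)) * (2 / (B ^ n / (d : ℝ) ^ t₀) ^ (1 / t₁))) ^ s ≤
      4 * B ^ (-(n * lurothExponent t₀ t₁ s)) * (d : ℝ)⁻¹ := by
  have hs0 : 0 < s := by linarith
  set f := lurothExponent t₀ t₁ s with hf
  obtain ⟨hf1, hf2⟩ := lurothExponent_mul_le ht₀ ht₁ hs0
  rw [← hf] at hf1 hf2
  have hB0 : 0 < B := by linarith
  have hd' : (2 : ℝ) ≤ d := by exact_mod_cast hd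
  have hd0 : (0 : ℝ) < d := by linarith
  set Y := (B ^ n / (d : ℝ) ^ t₀) ^ (1 / t₁) with hY
  have hY0 : 0 < Y := by positivity
  have hlogY : Real.log Y = (n * Real.log B - t₀ * Real.log d) / t₁ := by
    rw [hY, Real.log_rpow (by positivity), Real.log_div (by positivity) (by positivity),
      Real.log_pow, Real.log_rpow hd0]
    ring
  have hb : 0 < Real.log B := Real.log_pos hB
  have hδ0 : 0 ≤ Real.log d := Real.log_nonneg (by linarith)
  have hδ1 : Real.log d * s ≤ n * Real.log B * f := by
    have := Real.log_le_log hd0 hdX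
    rw [Real.log_rpow hB0] at this
    calc Real.log d * s ≤ (n * (f / s) * Real.log B) * s := by gcongr
      _ = _ := by field_simp
  have hkey : B ^ (n * f) * d ≤ ((d : ℝ) ^ 2 * Y) ^ s := by
    rw [← Real.log_le_log_iff (by positivity) (by positivity), Real.log_mul (by positivity)
      (by positivity), Real.log_rpow hB0, Real.log_rpow (by positivity), Real.log_mul
      (by positivity) (by positivity), Real.log_pow, hlogY]
    generalize Real.log d = δ at *
    have hnb : 0 ≤ n * Real.log B := by positivity
    rw [mul_right_comm]
    generalize (n : ℝ) * Real.log B = w at *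
    have : (w * f + δ) * t₁ ≤ s * (2 * δ * t₁ + (w - t₀ * δ)) := by
      -- Right side minus left side is affine in δ with this slope, so on the allowed range it is
      -- least at δ = 0, where `hf2` applies, or at δ s = w f, where `hf1` applies.
      rcases le_total 0 (2 * s * t₁ - s * t₀ - t₁) with hc | hc
      · nlinarith [mul_nonneg hc hδ0, mul_le_mul_of_nonneg_left hf2 hnb]
      · have h1 := mul_le_mul_of_nonpos_left hδ1 hc
        have h2 := mul_le_mul_of_nonneg_left hf1 hnb
        refine le_of_mul_le_mul_right ?_ hs0
        nlinarith
    push_cast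
    rw [show s * (2 * δ + (w - t₀ * δ) / t₁) = s * (2 * δ * t₁ + (w - t₀ * δ)) / t₁ by
      field_simp, le_div_iff₀ ht₁]
    exact this
  have h1 : 1 / ((d : ℝ) * (d - 1)) * (2 / Y) ≤ 4 * (d ^ 2 * Y)⁻¹ := by
    have hd1 : (0 : ℝ) < d - 1 := by linarith
    rw [← div_eq_mul_inv, one_div_mul_eq_div, div_div, div_le_div_iff₀ (by positivity) (by positivity)]
    have : (d : ℝ) ^ 2 ≤ 2 * (d * (d - 1)) := by nlinarith
    nlinarith
  have hd1 : (0 : ℝ) < d - 1 := by linarith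
  calc (1 / ((d : ℝ) * (d - 1)) * (2 / Y)) ^ s ≤ (4 * (d ^ 2 * Y)⁻¹) ^ s := by gcongr
    _ = 4 ^ s * (((d : ℝ) ^ 2 * Y) ^ s)⁻¹ := by
      rw [Real.mul_rpow (by norm_num) (by positivity), Real.inv_rpow (by positivity)]
    _ ≤ 4 ^ (1 : ℝ) * (B ^ (n * f) * d)⁻¹ := by
      gcongr
      norm_num
    _ = _ := by rw [Real.rpow_one, mul_inv, Real.rpow_neg hB0.le, mul_assoc]

lemma hasCountableCover_lurothProduct (ht₀ : 0 < t₀) (ht₁ : 0 < t₁) (hB : 1 < B) (hs : 1 / 2 < s)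
    (hs1 : s ≤ 1) (n : ℕ) :
    HasCountableCover s {x | x ∈ Ioc (0 : ℝ) 1 ∧
        B ^ n ≤ (lurothFirstDigit x : ℝ) ^ t₀ * (lurothFirstDigit (lurothMap x) : ℝ) ^ t₁} 1
      (ENNReal.ofReal ((6 + 4 * (n * (lurothExponent t₀ t₁ s / s * Real.log B))) *
        B ^ (-(n * lurothExponent t₀ t₁ s)))) := by
  have hs0 : 0 < s := by linarith
  have hf := lurothExponent_pos ht₀ ht₁ hs0
  set f := lurothExponent t₀ t₁ s with hf_def
  have hB0 : 0 < B := by linarith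
  set X : ℝ := B ^ (n * (f / s)) with hX
  -- The cutoff X makes (2/X)^s of order B^(-n f): points with first digit above X fit in one
  -- interval at 0. For a first digit d ≤ X the second digit must be at least Y d.
  have hX1 : 1 ≤ X := Real.one_le_rpow hB.le (by positivity)
  set Y : ℕ → ℝ := fun d => (B ^ n / (d : ℝ) ^ t₀) ^ (1 / t₁) with hY
  set F := Finset.Icc 2 ⌊X⌋₊ with hF
  -- Intersecting with [0, 1] makes every diameter at most 1, uniformly in n.
  set t : Option F → Set ℝ := fun o => (o.elim (Icc 0 (2 / X))
    fun d => lurothBranch d '' Icc 0 (2 / Y d)) ∩ Icc 0 1 with ht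
  have hnone : ediam (t none) ≤ ENNReal.ofReal (2 / X) := by
    refine (ediam_mono inter_subset_left).trans ?_
    simp [Real.ediam_Icc]
  have hsome (d : F) : ediam (t (some d)) ≤
      ENNReal.ofReal (1 / ((d : ℝ) * (d - 1)) * (2 / Y d)) := by
    refine (ediam_mono inter_subset_left).trans ?_
    have hd : 2 ≤ (d : ℕ) := (Finset.mem_Icc.1 d.2).1
    refine ((lipschitzWith_lurothBranch hd).ediam_image_le _).trans_eq ?_
    have hd' : (2 : ℝ) ≤ (d : ℕ) := by exact_mod_cast hd
    have h1 : (0 : ℝ) < ((d : ℕ) : ℝ) - 1 := by linarith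
    rw [Real.ediam_Icc, sub_zero, ENNReal.ofReal_mul (by positivity)]
    rfl
  refine ⟨Option F, inferInstance, t, ?_, ?_, ?_⟩
  · rintro x ⟨hx, hxB⟩
    rw [mem_iUnion]
    by_cases hdX : lurothFirstDigit x ≤ ⌊X⌋₊
    · refine ⟨some ⟨lurothFirstDigit x, Finset.mem_Icc.2 ⟨two_le_lurothFirstDigit hx, hdX⟩⟩, ?_,
        Ioc_subset_Icc_self hx⟩
      refine ⟨lurothMap x, ⟨(lurothMap_mem hx).1.le, ?_⟩, lurothBranch_lurothMap hx⟩
      have hLx := lurothMap_mem hx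
      have hd : (0 : ℝ) < lurothFirstDigit x := by
        have := two_le_lurothFirstDigit hx
        positivity
      have hY0 : 0 < Y (lurothFirstDigit x) := by simp only [hY]; positivity
      have h1 : Y (lurothFirstDigit x) ≤ lurothFirstDigit (lurothMap x) := by
        rw [← div_le_iff₀' (by positivity)] at hxB
        calc _ ≤ ((lurothFirstDigit (lurothMap x) : ℝ) ^ t₁) ^ (1 / t₁) := by
              simp only [hY]; gcongr
          _ = _ := by rw [← Real.rpow_mul (by positivity), mul_one_div_cancel ht₁.ne',
                Real.rpow_one]
      have h2 := h1.trans (lurothFirstDigit_le hLx)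
      rw [le_div_iff₀ hLx.1] at h2
      rw [le_div_iff₀ hY0]
      linarith
    · refine ⟨none, ⟨hx.1.le, ?_⟩, Ioc_subset_Icc_self hx⟩
      push Not at hdX
      have h1 := (Nat.lt_of_floor_lt hdX).le.trans (lurothFirstDigit_le hx)
      rw [le_div_iff₀ hx.1] at h1
      rw [le_div_iff₀ (by positivity)]
      linarith
  · intro i
    refine (ediam_mono inter_subset_right).trans ?_
    simp [Real.ediam_Icc]
  · rw [tsum_fintype, Fintype.sum_option]
    have h1 : ediam (t none) ^ s ≤ ENNReal.ofReal (2 * B ^ (-(n * f))) := by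
      refine (ENNReal.rpow_le_rpow hnone hs0.le).trans ?_
      rw [ENNReal.ofReal_rpow_of_nonneg (by positivity) hs0.le]
      apply ENNReal.ofReal_le_ofReal
      rw [Real.div_rpow (by norm_num) (by positivity), hX, ← Real.rpow_mul hB0.le,
        Real.rpow_neg hB0.le, div_eq_mul_inv, show n * (f / s) * s = n * f by field_simp]
      gcongr
      calc (2 : ℝ) ^ s ≤ 2 ^ (1 : ℝ) := Real.rpow_le_rpow_of_exponent_le (by norm_num) hs1
        _ = 2 := Real.rpow_one 2
    have h2 : ∑ d : F, ediam (t (some d)) ^ s ≤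
        ENNReal.ofReal (4 * B ^ (-(n * f)) * (1 + Real.log X)) := by
      calc ∑ d : F, ediam (t (some d)) ^ s
          ≤ ∑ d : F, ENNReal.ofReal (4 * B ^ (-(n * f)) * ((d : ℕ) : ℝ)⁻¹) := by
            refine Finset.sum_le_sum fun d _ => ?_
            have hd := Finset.mem_Icc.1 d.2
            have hd' : (2 : ℝ) ≤ (d : ℕ) := by exact_mod_cast hd.1
            have hd1 : (0 : ℝ) < ((d : ℕ) : ℝ) - 1 := by linarith
            refine (ENNReal.rpow_le_rpow (hsome d) hs0.le).trans ?_
            rw [ENNReal.ofReal_rpow_of_nonneg (by simp only [hY]; positivity) hs0.le]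
            apply ENNReal.ofReal_le_ofReal
            exact lurothCover_diam_rpow_le ht₀ ht₁ hB hs hs1 n hd.1
              ((Nat.le_floor_iff (by positivity)).1 hd.2)
        _ = ENNReal.ofReal (4 * B ^ (-(n * f)) * ∑ d ∈ F, (d : ℝ)⁻¹) := by
            rw [Finset.sum_coe_sort F fun d => ENNReal.ofReal (4 * B ^ (-(n * f)) * (d : ℝ)⁻¹),
              ← ENNReal.ofReal_sum_of_nonneg (fun d _ => by positivity), Finset.mul_sum]
        _ ≤ _ := by
            apply ENNReal.ofReal_le_ofReal
            gcongr
            refine le_trans ?_ (harmonic_floor_le_one_add_log X hX1)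
            rw [harmonic_eq_sum_Icc]
            push_cast
            exact Finset.sum_le_sum_of_subset_of_nonneg
              (Finset.Icc_subset_Icc_left (by norm_num)) fun d _ _ => by positivity
    refine (add_le_add h1 h2).trans_eq ?_
    have : 0 ≤ Real.log X := Real.log_nonneg hX1
    rw [← ENNReal.ofReal_add (by positivity) (by positivity), hX, Real.log_rpow hB0]
    congr 1
    ring

lemma summable_lurothCoverCost {Z : ℝ} (hZ : 0 ≤ Z) {f q : ℝ} (hB : 1 < B)
    (h : Z < B ^ f) :
    Summable fun n : ℕ => Z ^ n * ((6 + 4 * ((n + 1 : ℕ) * q)) * B ^ (-((n + 1 : ℕ) * f))) := by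
  have hB0 : 0 < B := by linarith
  have hBf : 0 < B ^ f := Real.rpow_pos_of_pos hB0 _
  have hρ : ‖Z / B ^ f‖ < 1 := by
    rw [Real.norm_of_nonneg (by positivity), div_lt_one hBf]
    exact h
  have h1 := (summable_geometric_of_norm_lt_one hρ).mul_left ((6 + 4 * q) / B ^ f)
  have h2 := (summable_pow_mul_geometric_of_norm_lt_one 1 hρ).mul_left (4 * q / B ^ f)
  refine (h1.add h2).congr fun n => ?_
  rw [Real.rpow_neg hB0.le, mul_comm _ f, Real.rpow_mul hB0.le, Real.rpow_natCast, pow_succ (B ^ f)]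
  push_cast
  rw [div_pow]
  field_simp
  ring

theorem dimH_lurothProductSet_le (ht₀ : 0 < t₀) (ht₁ : 0 < t₁) (hB : 1 < B)
    (hs : 1 / 2 < s) (hs1 : s ≤ 1) (h : lurothZeta s < B ^ lurothExponent t₀ t₁ s) :
    dimH (lurothProductSet t₀ t₁ B) ≤ ENNReal.ofReal s := by
  have hs0 : 0 < s := by linarith
  have hf := lurothExponent_pos ht₀ ht₁ hs0
  have hcover (n : ℕ) := (hasCountableCover_lurothProduct ht₀ ht₁ hB hs hs1
    (n + 1)).preimage_iterate_lurothMap hs n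
  have hlog : 0 ≤ Real.log B := Real.log_nonneg hB.le
  have hB0 : 0 < B := by linarith
  have hZ := lurothZeta_pos hs
  have hzero : μH[s] (lurothProductSet t₀ t₁ B) = 0 := by
    refine hausdorffMeasure_eq_zero_of_hasCountableCover hcover ?_ ?_ ?_ ?_
    · intro m n hmn
      simp only [mul_one]
      exact pow_le_pow_right_of_le_one' (by simp) hmn
    · simp only [mul_one]
      exact ENNReal.tendsto_pow_atTop_nhds_zero_of_lt_one (by simp)
    · have hsum := summable_lurothCoverCost (q := lurothExponent t₀ t₁ s / s * Real.log B)
        hZ.le hB h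
      convert hsum.tsum_ofReal_ne_top using 3 with n
      rw [ENNReal.ofReal_mul (p := lurothZeta s ^ n) (by positivity), ENNReal.ofReal_pow hZ.le]
    · rintro x ⟨hx, hinf⟩
      -- The condition on digits n and n + 1 is a condition on the iterate of order n - 1; this
      -- shift is injective because n ≥ 1.
      refine (hinf.image (f := fun n => n - 1) ?_).mono ?_
      · rintro m ⟨hm, -⟩ n ⟨hn, -⟩ hmn
        have : m - 1 = n - 1 := hmn
        omega
      · rintro _ ⟨n, ⟨hn1, hn⟩, rfl⟩
        obtain ⟨m, rfl⟩ : ∃ m, n = m + 1 := ⟨n - 1, by omega⟩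
        refine ⟨hx, iterate_lurothMap_mem hx _, ?_⟩
        simp only [lurothDigit, Nat.add_sub_cancel, Function.iterate_succ_apply'] at hn
        exact hn
  have h0 : μH[((Real.toNNReal s : ℝ≥0) : ℝ)] (lurothProductSet t₀ t₁ B) ≠ ∞ := by
    rw [Real.coe_toNNReal _ hs0.le, hzero]
    exact ENNReal.zero_ne_top
  exact dimH_le_of_hausdorffMeasure_ne_top h0

end

/-! ### Points with prescribed digits. -/

/-- The length of the Lüroth cylinder of the first `n` digits of `w`. -/
noncomputable def lurothLength (w : ℕ → ℕ) (n : ℕ) : ℝ :=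
  ∏ i ∈ Finset.range n, 1 / ((w i : ℝ) * ((w i : ℝ) - 1))

/-- The point whose Lüroth digits are `w 0, w 1, …`. -/
noncomputable def lurothPoint (w : ℕ → ℕ) : ℝ := ∑' n, lurothLength w n / w n

section Point

variable {w : ℕ → ℕ}

lemma lurothLength_succ (w : ℕ → ℕ) (n : ℕ) :
    lurothLength w (n + 1) = lurothLength w n * (1 / ((w n : ℝ) * ((w n : ℝ) - 1))) :=
  Finset.prod_range_succ _ _

lemma lurothLength_add (w : ℕ → ℕ) (n i : ℕ) :
    lurothLength w (n + i) = lurothLength w n * lurothLength (fun j => w (n + j)) i :=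
  Finset.prod_range_add _ _ _

lemma lurothLength_congr {w w' : ℕ → ℕ} {n : ℕ} (h : ∀ i < n, w i = w' i) :
    lurothLength w n = lurothLength w' n :=
  Finset.prod_congr rfl fun i hi => by rw [h i (Finset.mem_range.1 hi)]

lemma lurothLength_pos (hw : ∀ i, 2 ≤ w i) (n : ℕ) : 0 < lurothLength w n := by
  refine Finset.prod_pos fun i _ => ?_
  have hd' : (2 : ℝ) ≤ w i := by exact_mod_cast hw i
  have h1 : (0 : ℝ) < (w i : ℝ) - 1 := by linarith
  positivity

lemma lurothLength_le (hw : ∀ i, 2 ≤ w i) (n : ℕ) : lurothLength w n ≤ (1 / 2) ^ n := by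
  induction n with
  | zero => simp [lurothLength]
  | succ n ih =>
    have hd' : (2 : ℝ) ≤ w n := by exact_mod_cast hw n
    rw [lurothLength_succ, pow_succ]
    have h0 : (0 : ℝ) ≤ 1 / ((w n : ℝ) * ((w n : ℝ) - 1)) := by
      have h1 : (0 : ℝ) < (w n : ℝ) - 1 := by linarith
      positivity
    refine mul_le_mul ih ?_ h0 (by positivity)
    apply one_div_le_one_div_of_le (by norm_num)
    nlinarith

lemma summable_lurothPoint (hw : ∀ i, 2 ≤ w i) : Summable fun n => lurothLength w n / w n := by
  refine (summable_geometric_of_lt_one (by norm_num) (by norm_num : (1 / 2 : ℝ) < 1)).of_nonneg_of_le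
    (fun n => div_nonneg (lurothLength_pos hw n).le (by positivity)) fun n => ?_
  refine (div_le_self (lurothLength_pos hw n).le ?_).trans (lurothLength_le hw n)
  exact_mod_cast (by norm_num : 1 ≤ 2).trans (hw n)

lemma lurothPoint_eq_add (hw : ∀ i, 2 ≤ w i) (n : ℕ) :
    lurothPoint w = ∑ i ∈ Finset.range n, lurothLength w i / w i +
      lurothLength w n * lurothPoint fun j => w (n + j) := by
  rw [lurothPoint, ← (summable_lurothPoint hw).sum_add_tsum_nat_add n, lurothPoint,
    ← tsum_mul_left]
  congr 2
  ext i
  rw [add_comm i n, lurothLength_add, mul_div_assoc]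

lemma lurothPoint_mem (hw : ∀ i, 2 ≤ w i) : lurothPoint w ∈ Ioc (0 : ℝ) 1 := by
  have hpos (n : ℕ) : 0 < lurothLength w n / w n := by
    have := lurothLength_pos hw n
    have := hw n
    positivity
  refine ⟨(summable_lurothPoint hw).tsum_pos (fun n => (hpos n).le) 0 (hpos 0), ?_⟩
  -- The partial sum is the left endpoint of the n-th cylinder, so this bounds its right endpoint.
  have h (n : ℕ) : ∑ i ∈ Finset.range n, lurothLength w i / w i + lurothLength w n ≤ 1 := by
    induction n with
    | zero => simp [lurothLength]
    | succ n ih =>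
      have h0 := lurothLength_pos hw n
      have hd' : (2 : ℝ) ≤ w n := by exact_mod_cast hw n
      have h1 : (0 : ℝ) < (w n : ℝ) - 1 := by linarith
      have h2 : lurothLength w n / w n + lurothLength w (n + 1) =
          lurothLength w n * (1 / ((w n : ℝ) - 1)) := by
        rw [lurothLength_succ]
        field_simp
        ring
      have h3 : 1 / ((w n : ℝ) - 1) ≤ 1 := by rw [div_le_one h1]; linarith
      rw [Finset.sum_range_succ]
      nlinarith
  exact Real.tsum_le_of_sum_range_le (fun n => (hpos n).le) fun n => by
    linarith [h n, lurothLength_pos hw n]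

lemma lurothPoint_eq_branch (hw : ∀ i, 2 ≤ w i) :
    lurothPoint w = lurothBranch (w 0) (lurothPoint fun j => w (j + 1)) := by
  have hd' : (2 : ℝ) ≤ w 0 := by exact_mod_cast hw 0
  have h1 : (0 : ℝ) < (w 0 : ℝ) - 1 := by linarith
  rw [lurothPoint_eq_add hw 1, lurothBranch]
  simp only [lurothLength, Finset.sum_range_succ, Finset.prod_range_succ, Finset.range_zero,
    Finset.sum_empty, Finset.prod_empty, add_comm 1]
  field_simp
  ring

lemma one_div_le_lurothPoint (hw : ∀ i, 2 ≤ w i) : 1 / (w 0 : ℝ) ≤ lurothPoint w := by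
  have h := (lurothPoint_mem fun i => hw (1 + i)).1
  have h1 := lurothLength_pos hw 1
  rw [lurothPoint_eq_add hw 1]
  simp only [Finset.sum_range_one]
  have : lurothLength w 0 = 1 := by simp [lurothLength]
  rw [this]
  have := mul_pos h1 h
  linarith

lemma lurothPoint_le_half (hw : ∀ i, 2 ≤ w i) (h3 : 3 ≤ w 0) : lurothPoint w ≤ 1 / 2 := by
  have h := (lurothPoint_mem fun i => hw (i + 1)).2
  have hd' : (3 : ℝ) ≤ w 0 := by exact_mod_cast h3
  rw [lurothPoint_eq_branch hw, lurothBranch, div_le_iff₀ (by nlinarith)]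
  nlinarith

lemma iterate_lurothMap_lurothPoint (hw : ∀ i, 2 ≤ w i) (n : ℕ) :
    lurothMap^[n] (lurothPoint w) = lurothPoint fun j => w (j + n) := by
  induction n with
  | zero => rfl
  | succ n ih =>
    rw [Function.iterate_succ_apply', ih, lurothPoint_eq_branch fun i => hw (i + n),
      lurothMap_branch (hw _) (lurothPoint_mem fun i => hw _)]
    simp only [add_assoc, add_comm 1]

lemma lurothDigit_lurothPoint (hw : ∀ i, 2 ≤ w i) (n : ℕ) :
    lurothDigit (n + 1) (lurothPoint w) = w n := by
  rw [lurothDigit, Nat.add_sub_cancel, iterate_lurothMap_lurothPoint hw,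
    lurothPoint_eq_branch fun i => hw (i + n),
    lurothFirstDigit_branch (hw _) (lurothPoint_mem fun i => hw _), zero_add]

lemma measurable_lurothPoint : Measurable lurothPoint := by
  have h (n : ℕ) : Measurable fun w : ℕ → ℕ => lurothLength w n / w n := by
    refine Measurable.div (Finset.measurable_prod _ fun i _ => ?_) ?_
    · exact (measurable_from_nat (f := fun d : ℕ => 1 / ((d : ℝ) * ((d : ℝ) - 1)))).comp
        (measurable_pi_apply i)
    · exact (measurable_from_nat (f := fun d : ℕ => (d : ℝ))).comp (measurable_pi_apply n)
  exact Measurable.tsum h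

/-- Larger digits lie further left. The common prefix acts as an affine map with ratio its cylinder
length, which reduces the claim to `lurothBranch_sub_ge`; a next digit ≥ 3 keeps the left point off
its right end, one ≤ M keeps the right point off its left end. -/
lemma lurothPoint_sub_ge {w w' : ℕ → ℕ} (hw : ∀ i, 2 ≤ w i) (hw' : ∀ i, 2 ≤ w' i) {n M : ℕ}
    (hM : 2 ≤ M) (hpre : ∀ i < n, w i = w' i) (hn : w' n < w n)
    (hgap : 3 ≤ w (n + 1) ∨ w' (n + 1) ≤ M) :
    lurothLength w n * (((w n : ℝ) - w' n) / (w' n * w n) / M) ≤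
      lurothPoint w' - lurothPoint w := by
  have hsum : ∑ i ∈ Finset.range n, lurothLength w i / w i =
      ∑ i ∈ Finset.range n, lurothLength w' i / w' i := by
    refine Finset.sum_congr rfl fun i hi => ?_
    have hi' := Finset.mem_range.1 hi
    rw [hpre i hi', lurothLength_congr fun j hj => hpre j (hj.trans hi')]
  rw [lurothPoint_eq_add hw n, lurothPoint_eq_add hw' n, hsum, ← lurothLength_congr hpre,
    add_sub_add_left_eq_sub, ← mul_sub]
  refine mul_le_mul_of_nonneg_left ?_ (lurothLength_pos hw n).le
  rw [lurothPoint_eq_branch fun i => hw (n + i), lurothPoint_eq_branch fun i => hw' (n + i)]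
  refine lurothBranch_sub_ge (hw' _) hn hM (lurothPoint_mem fun i => hw _)
    (lurothPoint_mem fun i => hw' _) ?_
  rcases hgap with h | h
  · exact Or.inl (lurothPoint_le_half (fun i => hw _) h)
  · right
    refine le_trans ?_ (one_div_le_lurothPoint fun i => hw' _)
    have h0 : (0 : ℝ) < w' (n + 1) := by
      have := hw' (n + 1)
      positivity
    apply one_div_le_one_div_of_le
    · exact h0
    · exact_mod_cast h

end Point

/-! ### Mass distribution principle for product measures. -/

section MassDistribution

variable {μ : ℕ → Measure ℕ} [∀ i, IsProbabilityMeasure (μ i)] {D : ℕ → Finset ℕ} {ρ : ℕ → ℝ}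
  {s C : ℝ} {M : ℕ}

/-- Mass and length are both multiplicative along digits, so a bound ρ on each one-digit ratio of
mass to length^s multiplies up. -/
lemma infinitePi_prefix_le (hρ : ∀ i, ∀ d ∈ D i, (μ i).real {d} * ((d : ℝ) * (d - 1)) ^ s ≤ ρ i)
    (hD : ∀ i, ∀ d ∈ D i, 2 ≤ d) {w : ℕ → ℕ} (hw : ∀ i, w i ∈ D i) (n : ℕ) (T : Set ℕ) :
    Measure.infinitePi μ {v | (∀ i < n, v i = w i) ∧ v n ∈ T} ≤
      ENNReal.ofReal ((∏ i ∈ Finset.range n, ρ i) * (μ n).real T * lurothLength w n ^ s) := by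
  have hw2 : ∀ i, 2 ≤ w i := fun i => hD i _ (hw i)
  set t : ℕ → Set ℕ := fun i => if i < n then {w i} else T with ht
  have hset : {v : ℕ → ℕ | (∀ i < n, v i = w i) ∧ v n ∈ T} =
      Set.pi (Finset.range (n + 1)) t := by
    ext v
    simp only [mem_ofPred_eq, Set.mem_pi, Finset.coe_range, mem_Iio, ht]
    constructor
    · rintro ⟨h1, h2⟩ i hi
      rcases Nat.lt_succ_iff_lt_or_eq.1 hi with h | rfl
      · simp [h, h1 i h]
      · simpa using h2
    · intro h
      refine ⟨fun i hi => ?_, by simpa using h n (by omega)⟩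
      simpa [hi] using h i (by omega)
  have h1 : ∏ i ∈ Finset.range n, μ i (t i) = ENNReal.ofReal (∏ i ∈ Finset.range n,
      (μ i).real {w i}) := by
    rw [ENNReal.ofReal_prod_of_nonneg fun i _ => measureReal_nonneg]
    refine Finset.prod_congr rfl fun i hi => ?_
    rw [ofReal_measureReal]
    simp [ht, Finset.mem_range.1 hi]
  have h2 : t n = T := by simp [ht]
  rw [hset, Measure.infinitePi_pi _ fun i _ => MeasurableSet.of_discrete, Finset.prod_range_succ,
    h1, h2, ← ofReal_measureReal (μ := μ n), ← ENNReal.ofReal_mul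
      (Finset.prod_nonneg fun i _ => measureReal_nonneg)]
  apply ENNReal.ofReal_le_ofReal
  rw [mul_right_comm]
  refine mul_le_mul_of_nonneg_right ?_ measureReal_nonneg
  have hpos (i : ℕ) : (0 : ℝ) < 1 / ((w i : ℝ) * ((w i : ℝ) - 1)) := by
    have hd' : (2 : ℝ) ≤ w i := by exact_mod_cast hw2 i
    have h1 : (0 : ℝ) < (w i : ℝ) - 1 := by linarith
    positivity
  rw [lurothLength, ← Real.finsetProd_rpow _ _ (fun i _ => (hpos i).le), ← Finset.prod_mul_distrib]
  refine Finset.prod_le_prod (fun i _ => measureReal_nonneg) fun i _ => ?_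
  have hp : (0 : ℝ) < (w i : ℝ) * ((w i : ℝ) - 1) := one_div_pos.1 (hpos i)
  rw [one_div, Real.inv_rpow hp.le, ← div_eq_mul_inv, le_div_iff₀ (Real.rpow_pos_of_pos hp s)]
  exact hρ i _ (hw i)

/-- The product measure, pushed to the line, gives any set J mass at most K diam(J)^s. Cylinders
alone are too coarse for this, so `hmass` also controls runs of digits a, …, b against their spread
(b - a)/(ab). -/
theorem le_dimH_image_lurothPoint (hs : 0 < s) (hM : 2 ≤ M) (hC : 0 < C)
    (hD : ∀ i, ∀ d ∈ D i, 2 ≤ d) (hμD : ∀ i, μ i (D i)ᶜ = 0)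
    (hgap : ∀ i, (∀ d ∈ D i, 3 ≤ d) ∨ ∀ d ∈ D i, d ≤ M)
    (hρ : ∀ i, ∀ d ∈ D i, (μ i).real {d} * ((d : ℝ) * (d - 1)) ^ s ≤ ρ i)
    (hρC : ∀ n, ∏ i ∈ Finset.range n, ρ i ≤ C)
    (hmass : ∀ n, ∀ a ∈ D n, ∀ b ∈ D n, a < b →
      (∏ i ∈ Finset.range n, ρ i) * (μ n).real (Icc a b) ≤ C * (((b : ℝ) - a) / (a * b)) ^ s) :
    ENNReal.ofReal s ≤ dimH (lurothPoint '' {w | ∀ i, w i ∈ D i}) := by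
  set P := Measure.infinitePi μ with hP
  set G : Set (ℕ → ℕ) := {w | ∀ i, w i ∈ D i} with hG
  have hG2 : ∀ w ∈ G, ∀ i, 2 ≤ w i := fun w hw i => hD i _ (hw i)
  have hGP : P Gᶜ = 0 := by
    have : ∀ᵐ w ∂P, ∀ i, w i ∈ D i := by
      rw [ae_all_iff]
      intro i
      have h := (measurePreserving_eval_infinitePi μ i).quasiMeasurePreserving.ae
        (p := fun d => d ∈ D i) (by rw [ae_iff]; exact hμD i)
      exact h
    exact this
  have hM0 : (0 : ℝ) < M := by positivity
  set K : ℝ := C * (M : ℝ) ^ s with hK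
  have hK0 : 0 < K := by positivity
  have hmain (J : Set ℝ) (hJ : ediam J ≠ ∞) :
      P (lurothPoint ⁻¹' J) ≤ ENNReal.ofReal K * ediam J ^ s := by
    have hF : P (lurothPoint ⁻¹' J) ≤ P (lurothPoint ⁻¹' J ∩ G) := by
      calc _ ≤ P (lurothPoint ⁻¹' J ∩ G ∪ Gᶜ) := measure_mono fun w hw => by
            by_cases h : w ∈ G
            · exact Or.inl ⟨hw, h⟩
            · exact Or.inr h
        _ ≤ _ := (measure_union_le _ _).trans_eq (by rw [hGP, add_zero])
    refine hF.trans ?_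
    set F := lurothPoint ⁻¹' J ∩ G with hFdef
    rcases F.eq_empty_or_nonempty with hemp | ⟨w₀, hw₀⟩
    · simp [hemp]
    by_cases hdiff : ∃ n, ∃ w ∈ F, w n ≠ w₀ n
    · classical
      -- n is the first index where the sequences landing in J disagree. With a, b the extreme
      -- digits there, they all lie in one prefix cylinder with n-th digit in [a, b], while J
      -- contains two points at least the corresponding gap apart.
      obtain ⟨w₁, hw₁, hn₁⟩ := Nat.find_spec hdiff
      have hpre : ∀ i < Nat.find hdiff, ∀ w ∈ F, w i = w₀ i := by
        intro i hi w hw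
        by_contra h
        exact Nat.find_min hdiff hi ⟨w, hw, h⟩
      generalize Nat.find hdiff = n at hn₁ hpre
      set T : Finset ℕ := {d ∈ D n | ∃ w ∈ F, w n = d} with hT
      have hTmem : ∀ w ∈ F, w n ∈ T := fun w hw =>
        Finset.mem_filter.2 ⟨hw.2 n, w, hw, rfl⟩
      have hTne : T.Nonempty := ⟨_, hTmem w₀ hw₀⟩
      obtain ⟨haD, w', hw', hwa⟩ := Finset.mem_filter.1 (T.min'_mem hTne)
      obtain ⟨hbD, w, hw, hwb⟩ := Finset.mem_filter.1 (T.max'_mem hTne)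
      have hmin : ∀ v ∈ F, T.min' hTne ≤ v n := fun v hv => T.min'_le _ (hTmem v hv)
      have hmax : ∀ v ∈ F, v n ≤ T.max' hTne := fun v hv => T.le_max' _ (hTmem v hv)
      generalize T.min' hTne = a at *
      generalize T.max' hTne = b at *
      have hab : a < b := by
        have h1 := hmin w₀ hw₀
        have h2 := hmax w₀ hw₀
        have h3 := hmin w₁ hw₁
        have h4 := hmax w₁ hw₁
        omega
      have hw2 := hG2 w hw.2
      have hsub := lurothPoint_sub_ge hw2 (hG2 w' hw'.2) hM (n := n)
        (fun i hi => by rw [hpre i hi w hw, hpre i hi w' hw']) (by rw [hwa, hwb]; exact hab)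
        ((hgap (n + 1)).imp (fun h => h _ (hw.2 _)) fun h => h _ (hw'.2 _))
      rw [hwa, hwb] at hsub
      have hℓ := lurothLength_pos hw2 n
      have ha0 : (0 : ℝ) < a := by
        have := hD n a haD
        positivity
      have hab' : (a : ℝ) < b := by exact_mod_cast hab
      have hb0 : (0 : ℝ) < b := ha0.trans hab'
      have hq : 0 < ((b : ℝ) - a) / (a * b) := div_pos (by linarith) (by positivity)
      have hd : ENNReal.ofReal (lurothLength w n * (((b : ℝ) - a) / (a * b) / M)) ≤ ediam J := by
        refine le_trans ?_ (edist_le_ediam_of_mem hw'.1 hw.1)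
        rw [edist_dist, Real.dist_eq]
        exact ENNReal.ofReal_le_ofReal (hsub.trans (le_abs_self _))
      calc P F ≤ P {v | (∀ i < n, v i = w i) ∧ v n ∈ Icc a b} := measure_mono fun v hv =>
            ⟨fun i hi => by rw [hpre i hi v hv, hpre i hi w hw], hmin v hv, hmax v hv⟩
        _ ≤ _ := infinitePi_prefix_le hρ hD hw.2 n _
        _ ≤ ENNReal.ofReal (K * (lurothLength w n * (((b : ℝ) - a) / (a * b) / M)) ^ s) := by
            apply ENNReal.ofReal_le_ofReal
            rw [Real.mul_rpow hℓ.le (by positivity), Real.div_rpow hq.le hM0.le, hK]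
            calc _ ≤ C * (((b : ℝ) - a) / (a * b)) ^ s * lurothLength w n ^ s := by
                  exact mul_le_mul_of_nonneg_right (hmass n a haD b hbD hab)
                    (Real.rpow_nonneg hℓ.le _)
              _ = _ := by field_simp
        _ = ENNReal.ofReal K * ENNReal.ofReal (lurothLength w n * (((b : ℝ) - a) / (a * b) / M)) ^ s
            := by rw [ENNReal.ofReal_mul hK0.le, ENNReal.ofReal_rpow_of_nonneg (by positivity) hs.le]
        _ ≤ _ := by gcongr
    -- All sequences coincide, and a single sequence has mass zero.
    · push Not at hdiff
      have hle (n : ℕ) : P F ≤ ENNReal.ofReal (C * ((1 / 2) ^ n) ^ s) := by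
        calc P F ≤ P {v | (∀ i < n, v i = w₀ i) ∧ v n ∈ univ} := measure_mono fun v hv =>
              ⟨fun i _ => hdiff i v hv, mem_univ _⟩
          _ ≤ _ := infinitePi_prefix_le hρ hD hw₀.2 n _
          _ ≤ _ := by
              apply ENNReal.ofReal_le_ofReal
              rw [probReal_univ, mul_one]
              have h1 := lurothLength_pos (hG2 w₀ hw₀.2) n
              have h2 := lurothLength_le (hG2 w₀ hw₀.2) n
              have h3 := hρC n
              gcongr
      have hlim : Tendsto (fun n : ℕ => ENNReal.ofReal (C * ((1 / 2 : ℝ) ^ n) ^ s)) atTop (𝓝 0) := by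
        rw [← ENNReal.ofReal_zero]
        refine ENNReal.tendsto_ofReal ?_
        have h1 : Tendsto (fun n : ℕ => ((1 / 2 : ℝ) ^ n) ^ s) atTop (𝓝 (0 ^ s)) :=
          (tendsto_pow_atTop_nhds_zero_of_lt_one (by norm_num) (by norm_num)).rpow_const
            (Or.inr hs.le)
        rw [Real.zero_rpow hs.ne'] at h1
        simpa using h1.const_mul C
      have : P F ≤ 0 := ge_of_tendsto' hlim hle
      exact this.trans bot_le
  have hKne : ENNReal.ofReal K ≠ 0 := by simpa using hK0
  set ν : Measure ℝ := (ENNReal.ofReal K)⁻¹ • P.map lurothPoint with hν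
  have hle : ν ≤ μH[s] := by
    refine Measure.le_hausdorffMeasure s ν 1 one_pos fun J hJ => ?_
    -- Passing to the closure gives measurability without changing the diameter.
    have hcl : MeasurableSet (closure J) := isClosed_closure.measurableSet
    calc ν J ≤ ν (closure J) := measure_mono subset_closure
      _ = (ENNReal.ofReal K)⁻¹ * P (lurothPoint ⁻¹' closure J) := by
          rw [hν, Measure.smul_apply, Measure.map_apply measurable_lurothPoint hcl, smul_eq_mul]
      _ ≤ (ENNReal.ofReal K)⁻¹ * (ENNReal.ofReal K * ediam (closure J) ^ s) := by
          gcongr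
          exact hmain _ (by
            rw [ediam_closure]
            exact (hJ.trans_lt ENNReal.one_lt_top).ne)
      _ = ediam J ^ s := by
          rw [← mul_assoc, ENNReal.inv_mul_cancel hKne ENNReal.ofReal_ne_top, one_mul, ediam_closure]
  have hν0 : 0 < ν (lurothPoint '' G) := by
    have h1 : 1 ≤ P.map lurothPoint (lurothPoint '' G) := by
      calc (1 : ℝ≥0∞) = P univ := measure_univ.symm
        _ ≤ P (G ∪ Gᶜ) := by rw [union_compl_self]
        _ ≤ P G + P Gᶜ := measure_union_le _ _
        _ = P G := by rw [hGP, add_zero]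
        _ ≤ P (lurothPoint ⁻¹' (lurothPoint '' G)) := measure_mono (subset_preimage_image _ _)
        _ ≤ _ := Measure.le_map_apply measurable_lurothPoint.aemeasurable _
    rw [hν, Measure.smul_apply, smul_eq_mul]
    exact ENNReal.mul_pos (ENNReal.inv_ne_zero.2 ENNReal.ofReal_ne_top) (one_pos.trans_le h1).ne'
  have h0 : μH[((Real.toNNReal s : ℝ≥0) : ℝ)] (lurothPoint '' G) ≠ 0 := by
    rw [Real.coe_toNNReal _ hs.le]
    exact (hν0.trans_le (hle _)).ne'
  exact le_dimH_of_hausdorffMeasure_ne_zero h0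

end MassDistribution

/-! ### Placement of the large digits. -/

/-- Greedy choice of the positions carrying pairs of large digits. The first component is the
accumulated ratio of the mass to the `s`-th power of the length of a cylinder, the second one tells
whether the previous position opened a pair. A pair is opened at `m` as soon as the ratio is at most
`θ ^ (-(m + 1))`; it multiplies the ratio by `u m` and `v (m + 1)`, other positions by `S⁻¹`. -/
noncomputable def lurothSchedule (S θ : ℝ) (u v : ℕ → ℝ) : ℕ → ℝ × Bool
  | 0 => (1, false)
  | m + 1 =>
    let p := lurothSchedule S θ u v m
    if p.2 then (p.1 * v m, false)
    else open Classical in if p.1 ≤ (θ ^ (m + 1))⁻¹ then (p.1 * u m, true) else (p.1 * S⁻¹, false)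

/-- In κ, `none` is a free position and `some false`, `some true` are the first and second members
of a pair. A pair raises the ratio P by at most C θ^(m+1), which the opening threshold cancels; free
positions shrink P by S⁻¹ < θ⁻¹, so the threshold is always reached again. -/
lemma exists_lurothSchedule {S θ C : ℝ} (hθ : 1 ≤ θ) (hS : θ < S) (hC : 1 ≤ C) {u v : ℕ → ℝ}
    (hu : ∀ m, 0 ≤ u m) (hv : ∀ m, 0 ≤ v m) (huC : ∀ m, u m ≤ C * θ ^ (m + 1))
    (huv : ∀ m, u m * v (m + 1) ≤ C * θ ^ (m + 1)) :
    ∃ (κ : ℕ → Option Bool) (P : ℕ → ℝ),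
      (∀ n, P n = ∏ i ∈ Finset.range n, (κ i).elim S⁻¹ fun b => if b then v i else u i) ∧
      (∀ n, 0 ≤ P n ∧ P n ≤ C) ∧
      (∀ n, κ n = some false → P n ≤ (θ ^ (n + 1))⁻¹ ∧ κ (n + 1) = some true) ∧
      (∀ n, κ n = some true → ∃ m, n = m + 1 ∧ κ m = some false) ∧
      {n | κ n = some false}.Infinite := by
  classical
  set σ := lurothSchedule S θ u v with hσ
  have hσ0 : σ 0 = (1, false) := rfl
  have hσs (m : ℕ) : σ (m + 1) = if (σ m).2 then ((σ m).1 * v m, false) else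
      if (σ m).1 ≤ (θ ^ (m + 1))⁻¹ then ((σ m).1 * u m, true) else ((σ m).1 * S⁻¹, false) := by
    rw [hσ, lurothSchedule]
  set κ : ℕ → Option Bool := fun n => if (σ n).2 then some true else
    if (σ n).1 ≤ (θ ^ (n + 1))⁻¹ then some false else none with hκ
  have hS0 : 0 < S := by linarith
  have hθ0 : 0 < θ := by linarith
  have hSi : S⁻¹ ≤ 1 := inv_le_one_of_one_le₀ (by linarith)
  have hfirst (n : ℕ) (h : κ n = some false) : (σ n).1 ≤ (θ ^ (n + 1))⁻¹ ∧
      σ (n + 1) = ((σ n).1 * u n, true) := by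
    simp only [hκ] at h
    split_ifs at h with h1 h2
    · exact absurd h (by simp)
    · exact ⟨h2, by rw [hσs, if_neg h1, if_pos h2]⟩
  have hnone (n : ℕ) (h : κ n = none) : (θ ^ (n + 1))⁻¹ < (σ n).1 ∧
      σ (n + 1) = ((σ n).1 * S⁻¹, false) := by
    simp only [hκ] at h
    split_ifs at h with h1 h2
    exact ⟨not_le.1 h2, by rw [hσs, if_neg h1, if_neg h2]⟩
  have hsecond (n : ℕ) (h : κ n = some true) : (σ n).2 = true ∧
      σ (n + 1) = ((σ n).1 * v n, false) := by
    simp only [hκ] at h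
    split_ifs at h with h1 h2
    · exact ⟨h1, by rw [hσs, if_pos h1]⟩
    · exact absurd h (by simp)
  have hprev (n : ℕ) (h : κ n = some true) : ∃ m, n = m + 1 ∧ κ m = some false := by
    have h2 := (hsecond n h).1
    cases n with
    | zero => simp [hσ0] at h2
    | succ m =>
      refine ⟨m, rfl, ?_⟩
      rcases hm : κ m with _ | _ | _
      · simp [(hnone m hm).2] at h2
      · rfl
      · simp [(hsecond m hm).2] at h2
  have hnonneg (n : ℕ) : 0 ≤ (σ n).1 := by
    induction n with
    | zero => simp [hσ0]
    | succ n ih =>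
      rcases hn : κ n with _ | _ | _
      · rw [(hnone n hn).2]; positivity
      · rw [(hfirst n hn).2]; exact mul_nonneg ih (hu n)
      · rw [(hsecond n hn).2]; exact mul_nonneg ih (hv n)
  have hstep (m : ℕ) (x : ℝ) (hx0 : 0 ≤ x) (hx : x ≤ C * θ ^ (m + 1))
      (h : (σ m).1 ≤ (θ ^ (m + 1))⁻¹) : (σ m).1 * x ≤ C := by
    calc (σ m).1 * x ≤ (θ ^ (m + 1))⁻¹ * (C * θ ^ (m + 1)) := by gcongr
      _ = C := by field_simp
  refine ⟨κ, fun n => (σ n).1, ?_, ?_, ?_, hprev, ?_⟩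
  · intro n
    induction n with
    | zero => simp [hσ0]
    | succ n ih =>
      simp only at ih ⊢
      rw [Finset.prod_range_succ, ← ih]
      rcases hn : κ n with _ | _ | _
      · simp [(hnone n hn).2]
      · simp [(hfirst n hn).2]
      · simp [(hsecond n hn).2]
  · intro n
    refine ⟨hnonneg n, ?_⟩
    induction n with
    | zero => simpa [hσ0] using hC
    | succ n ih =>
      simp only at ih ⊢
      rcases hn : κ n with _ | _ | _
      · rw [(hnone n hn).2]
        exact (mul_le_of_le_one_right (hnonneg n) hSi).trans ih
      · rw [(hfirst n hn).2]
        exact hstep n _ (hu n) (huC n) (hfirst n hn).1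
      · obtain ⟨m, rfl, hm⟩ := hprev n hn
        rw [(hsecond _ hn).2, (hfirst m hm).2]
        dsimp only
        rw [mul_assoc]
        exact hstep m _ (mul_nonneg (hu m) (hv _)) (huv m) (hfirst m hm).1
  · intro n hn
    refine ⟨(hfirst n hn).1, ?_⟩
    simp [hκ, (hfirst n hn).2]
  -- Were all positions eventually free, P would decay like S^(-k) yet stay above a threshold
  -- decaying like θ^(-k).
  · intro hfin
    obtain ⟨N, hN⟩ := hfin.bddAbove
    have hfree (n : ℕ) (hn : N + 2 ≤ n) : κ n = none := by
      rcases hκn : κ n with _ | _ | _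
      · rfl
      · have : n ≤ N := hN hκn
        omega
      · obtain ⟨m, rfl, hm⟩ := hprev n hκn
        have : m ≤ N := hN hm
        omega
    have hP (k : ℕ) : (σ (N + 2 + k)).1 = (σ (N + 2)).1 * (S⁻¹) ^ k := by
      induction k with
      | zero => simp
      | succ k ih =>
        rw [← add_assoc, (hnone _ (hfree _ (by omega))).2]
        simp only
        rw [ih, pow_succ, mul_assoc]
    have hlt (k : ℕ) : 1 < (σ (N + 2)).1 * θ ^ (N + 3) * (θ * S⁻¹) ^ k := by
      have h1 := (hnone _ (hfree (N + 2 + k) (by omega))).1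
      rw [hP, inv_lt_iff_one_lt_mul₀ (by positivity)] at h1
      calc 1 < _ := h1
        _ = _ := by rw [mul_pow]; ring
    have hlim : Tendsto (fun k : ℕ => (σ (N + 2)).1 * θ ^ (N + 3) * (θ * S⁻¹) ^ k) atTop (𝓝 0) := by
      rw [← mul_zero ((σ (N + 2)).1 * θ ^ (N + 3))]
      refine (tendsto_pow_atTop_nhds_zero_of_lt_one (by positivity) ?_).const_mul _
      rw [← div_eq_mul_inv, div_lt_one hS0]
      exact hS
    exact absurd (ge_of_tendsto' hlim fun k => (hlt k).le) (by norm_num)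

/-! ### Finitely supported digit distributions. -/

/-- The measure on `ℕ` giving the point `d ∈ D` the mass `p d`. -/
noncomputable def finsetMeasure (D : Finset ℕ) (p : ℕ → ℝ) : Measure ℕ :=
  ∑ d ∈ D, ENNReal.ofReal (p d) • Measure.dirac d

section FinsetMeasure

variable {D : Finset ℕ} {p : ℕ → ℝ}

lemma finsetMeasure_apply (hp : ∀ d ∈ D, 0 ≤ p d) (T : Set ℕ) :
    finsetMeasure D p T = ENNReal.ofReal (∑ d ∈ D, T.indicator p d) := by
  rw [finsetMeasure, Measure.finsetSum_apply, ENNReal.ofReal_sum_of_nonneg fun d hd =>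
    indicator_apply_nonneg fun _ => hp d hd]
  refine Finset.sum_congr rfl fun d _ => ?_
  rw [Measure.smul_apply, Measure.dirac_apply' _ MeasurableSet.of_discrete]
  by_cases h : d ∈ T <;> simp [h]

lemma isProbabilityMeasure_finsetMeasure (hp : ∀ d ∈ D, 0 ≤ p d) (h1 : ∑ d ∈ D, p d = 1) :
    IsProbabilityMeasure (finsetMeasure D p) :=
  ⟨by rw [finsetMeasure_apply hp]; simp [h1]⟩

lemma finsetMeasure_compl (hp : ∀ d ∈ D, 0 ≤ p d) : finsetMeasure D p (D : Set ℕ)ᶜ = 0 := by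
  rw [finsetMeasure_apply hp, Finset.sum_eq_zero fun d hd => ?_, ENNReal.ofReal_zero]
  exact indicator_of_notMem (by simpa using hd) _

lemma finsetMeasure_real_singleton (hp : ∀ d ∈ D, 0 ≤ p d) {d : ℕ} (hd : d ∈ D) :
    (finsetMeasure D p).real {d} = p d := by
  rw [Measure.real, finsetMeasure_apply hp, Finset.sum_eq_single d (fun e _ he => by simp [he])
    (fun h => absurd hd h), indicator_of_mem (mem_singleton d), ENNReal.toReal_ofReal (hp d hd)]

lemma finsetMeasure_const_real_Icc_le {c : ℝ} (hc : 0 ≤ c) {a b : ℕ} (hab : a < b) :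
    (finsetMeasure D fun _ => c).real (Icc a b) ≤ 2 * ((b : ℝ) - a) * c := by
  have hab' : (a : ℝ) + 1 ≤ b := by exact_mod_cast hab
  rw [Measure.real, finsetMeasure_apply fun _ _ => hc, ENNReal.toReal_ofReal
    (Finset.sum_nonneg fun d _ => indicator_apply_nonneg fun _ => hc), ← Finset.coe_Icc,
    Finset.sum_indicator_eq_sum_inter, Finset.sum_const, nsmul_eq_mul]
  gcongr
  have h1 : (D ∩ Finset.Icc a b).card ≤ b + 1 - a := by
    rw [← Nat.card_Icc]
    exact Finset.card_le_card Finset.inter_subset_right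
  calc ((D ∩ Finset.Icc a b).card : ℝ) ≤ ((b + 1 - a : ℕ) : ℝ) := by exact_mod_cast h1
    _ = (b : ℝ) + 1 - a := by rw [Nat.cast_sub (by omega)]; push_cast; ring
    _ ≤ _ := by linarith

end FinsetMeasure

lemma natCeil_add_two_le {x : ℝ} (hx : 1 ≤ x) : ((⌈x⌉₊ + 2 : ℕ) : ℝ) ≤ 4 * x := by
  have := (Nat.ceil_lt_add_one (zero_le_one.trans hx)).le
  push_cast
  linarith

lemma natCeil_add_two_rpow_le {x e : ℝ} (hx : 1 ≤ x) (he0 : 0 ≤ e) (he1 : e ≤ 1) (n : ℕ) :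
    ((⌈x ^ n⌉₊ + 2 : ℕ) : ℝ) ^ e ≤ 4 * (x ^ e) ^ n := by
  have hx0 : 0 ≤ x := by linarith
  calc ((⌈x ^ n⌉₊ + 2 : ℕ) : ℝ) ^ e ≤ (4 * x ^ n) ^ e :=
        Real.rpow_le_rpow (by positivity) (natCeil_add_two_le (one_le_pow₀ hx)) he0
    _ = 4 ^ e * (x ^ e) ^ n := by
        rw [Real.mul_rpow (by norm_num) (by positivity), ← Real.rpow_natCast x n,
          ← Real.rpow_mul hx0, ← Real.rpow_natCast (x ^ e), ← Real.rpow_mul hx0, mul_comm e]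
    _ ≤ 4 ^ (1 : ℝ) * (x ^ e) ^ n := by
        gcongr
        norm_num
    _ = _ := by rw [Real.rpow_one]

/-- Mass bound for runs of consecutive digits in a block `{L, …, 2L - 1}` of equal weights. -/
lemma mass_le_of_mem_Ico {s P c : ℝ} (hs0 : 0 ≤ s) (hs1 : s ≤ 1) {L a b : ℕ} (hP : 0 ≤ P)
    (hPL : P * (L : ℝ) ^ s ≤ c) (ha : a ∈ Finset.Ico L (2 * L)) (hb : b ∈ Finset.Ico L (2 * L))
    (hab : a < b) :
    P * (2 * ((b : ℝ) - a) * (1 / L)) ≤ 8 * c * (((b : ℝ) - a) / (a * b)) ^ s := by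
  rw [Finset.mem_Ico] at ha hb
  have hL0 : 0 < L := by omega
  have hL : (0 : ℝ) < L := by exact_mod_cast hL0
  have ha1 : (L : ℝ) ≤ a := by exact_mod_cast ha.1
  have ha2 : (a : ℝ) ≤ 2 * L := by exact_mod_cast ha.2.le
  have hb2 : (b : ℝ) ≤ 2 * L := by exact_mod_cast hb.2.le
  have hab' : (a : ℝ) < b := by exact_mod_cast hab
  have hb0 : (0 : ℝ) < b := by linarith
  have ha0 : (0 : ℝ) < a := by linarith
  set τ := ((b : ℝ) - a) / L with hτ
  have hτ0 : 0 < τ := div_pos (by linarith) hL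
  -- Since τ ≤ 1 and s ≤ 1, τ ≤ τ^s: this turns the linear mass of a run into an s-th power of its
  -- spread.
  have hτ1 : τ ≤ 1 := by rw [hτ, div_le_one hL]; linarith
  have h1 : (1 / 4) * τ * ((L : ℝ) ^ s)⁻¹ ≤ (((b : ℝ) - a) / (a * b)) ^ s := by
    calc (1 / 4) * τ * ((L : ℝ) ^ s)⁻¹ ≤ (1 / 4) ^ s * τ ^ s * ((L : ℝ) ^ s)⁻¹ := by
          gcongr
          · exact Real.self_le_rpow_of_le_one (by norm_num) (by norm_num) hs1
          · exact Real.self_le_rpow_of_le_one hτ0.le hτ1 hs1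
      _ = ((1 / 4) * τ * (L : ℝ)⁻¹) ^ s := by
          rw [Real.mul_rpow (by positivity) (by positivity), Real.mul_rpow (by positivity)
            hτ0.le, Real.inv_rpow hL.le]
      _ ≤ _ := by
          refine Real.rpow_le_rpow (by positivity) ?_ hs0
          rw [hτ, show 1 / 4 * (((b : ℝ) - a) / L) * (L : ℝ)⁻¹ = (b - a) / (2 * L * (2 * L)) by
            field_simp; ring]
          have : 0 ≤ (b : ℝ) - a := by linarith
          gcongr
  have hLs : 0 < (L : ℝ) ^ s := Real.rpow_pos_of_pos hL s
  have hc : 0 ≤ c := le_trans (by positivity) hPL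
  calc P * (2 * ((b : ℝ) - a) * (1 / L)) = 8 * (P * (L : ℝ) ^ s) * ((1 / 4) * τ * ((L : ℝ) ^ s)⁻¹) := by
        rw [hτ]; field_simp; ring
    _ ≤ _ := by gcongr

/-! ### The random construction and the lower bound. -/

section Construction

variable {t₀ t₁ B s : ℝ}

/-- Optimal growth rates of the pairs of large digits. -/
lemma exists_growth_rates (ht₀ : 0 < t₀) (ht₁ : 0 < t₁) (hB : 1 < B) (hs0 : 0 < s) (hs1 : s ≤ 1) :
    ∃ α β : ℝ, 1 ≤ α ∧ 1 ≤ β ∧ α ^ t₀ * β ^ t₁ = B ∧ α ^ s ≤ B ^ lurothExponent t₀ t₁ s ∧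
      α ^ (2 * s - 1) * β ^ s ≤ B ^ lurothExponent t₀ t₁ s := by
  have hB0 : 0 < B := by linarith
  suffices h : ∃ a b : ℝ, 0 ≤ a ∧ 0 ≤ b ∧ a * t₀ + b * t₁ = 1 ∧ a * s ≤ lurothExponent t₀ t₁ s ∧
      a * (2 * s - 1) + b * s ≤ lurothExponent t₀ t₁ s by
    obtain ⟨a, b, ha, hb, h1, h2, h3⟩ := h
    refine ⟨B ^ a, B ^ b, Real.one_le_rpow hB.le ha, Real.one_le_rpow hB.le hb, ?_, ?_, ?_⟩
    · rw [← Real.rpow_mul hB0.le, ← Real.rpow_mul hB0.le, ← Real.rpow_add hB0, h1, Real.rpow_one]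
    · rw [← Real.rpow_mul hB0.le]
      exact Real.rpow_le_rpow_of_exponent_le hB.le h2
    · rw [← Real.rpow_mul hB0.le, ← Real.rpow_mul hB0.le, ← Real.rpow_add hB0]
      exact Real.rpow_le_rpow_of_exponent_le hB.le h3
  rw [lurothExponent_eq ht₀ ht₁]
  have h1s : 0 ≤ 1 - s := by linarith
  have hden : 0 < t₀ * s + t₁ * (1 - s) := by positivity
  rcases max_cases (t₀ * s + t₁ * (1 - s)) (t₁ * s) with ⟨h, hle⟩ | ⟨h, hle⟩
  · rw [h]
    -- Here both cost constraints hold with equality. In the other case the large factor is put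
    -- entirely on the second digit.
    refine ⟨s / (t₀ * s + t₁ * (1 - s)), (1 - s) / (t₀ * s + t₁ * (1 - s)), by positivity,
      by positivity, by field_simp, ?_, ?_⟩
    · rw [div_mul_eq_mul_div, sq]
    · apply le_of_eq
      field_simp
      ring
  · rw [h]
    refine ⟨0, 1 / t₁, le_rfl, by positivity, by field_simp; ring, by simp; positivity, ?_⟩
    apply le_of_eq
    field_simp
    ring

/-- The two conditions on θ have different roles: α^s ≤ θ controls runs of the first digit of a
pair, and α^(2s-1) β^s ≤ θ controls runs of the second after the first has been chosen. -/
theorem le_dimH_of_truncated_sum {θ α β : ℝ} {M : ℕ} (hs : 1 / 2 < s) (hs1 : s ≤ 1)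
    (ht₀ : 0 < t₀) (ht₁ : 0 < t₁)
    (hα : 1 ≤ α) (hβ : 1 ≤ β) (hαβ : α ^ t₀ * β ^ t₁ = B) (hθ : 1 ≤ θ) (hαθ : α ^ s ≤ θ)
    (hαβθ : α ^ (2 * s - 1) * β ^ s ≤ θ) (hM : 2 ≤ M)
    (hS : θ < ∑ d ∈ Finset.Ico 2 M, ((d : ℝ) * ((d : ℝ) - 1)) ^ (-s)) :
    ENNReal.ofReal s ≤ dimH (lurothProductSet t₀ t₁ B) := by
  have hs0 : 0 < s := by linarith
  set S := ∑ d ∈ Finset.Ico 2 M, ((d : ℝ) * ((d : ℝ) - 1)) ^ (-s) with hSdef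
  have hS0 : 0 < S := by linarith
  -- Index n carries the digit numbered n + 1, and the second member of a pair opened at n sits at
  -- index n + 1; both sizes thus have exponent n + 1. Adding 2 keeps block digits at least 3, as
  -- the separation requires.
  set L : Bool → ℕ → ℕ := fun b n => if b then ⌈β ^ n⌉₊ + 2 else ⌈α ^ (n + 1)⌉₊ + 2 with hL
  have hL3 (b : Bool) (n : ℕ) : 3 ≤ L b n := by
    have h1 : 0 < ⌈β ^ n⌉₊ := Nat.ceil_pos.2 (by positivity)
    have h2 : 0 < ⌈α ^ (n + 1)⌉₊ := Nat.ceil_pos.2 (by positivity)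
    cases b
    · change 3 ≤ ⌈α ^ (n + 1)⌉₊ + 2
      omega
    · change 3 ≤ ⌈β ^ n⌉₊ + 2
      omega
  have hLpos (b : Bool) (n : ℕ) : (0 : ℝ) < L b n := by
    have := hL3 b n
    positivity
  set r : Bool → ℕ → ℝ := fun b n => 4 * (L b n : ℝ) ^ (2 * s - 1) with hr
  have hr0 (b : Bool) (n : ℕ) : 0 ≤ r b n := by simp only [hr]; positivity
  have hα0 : 0 < α := by linarith
  have hβ0 : 0 < β := by linarith
  have hαr (n : ℕ) : r false n ≤ 16 * (α ^ (2 * s - 1)) ^ (n + 1) := by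
    have := natCeil_add_two_rpow_le hα (e := 2 * s - 1) (by linarith) (by linarith) (n + 1)
    simp only [hr, hL, Bool.false_eq_true, if_false]
    linarith
  have hβr (n : ℕ) : r true n ≤ 16 * (β ^ s) ^ n := by
    have h1 := natCeil_add_two_rpow_le hβ (e := 2 * s - 1) (by linarith) (by linarith) n
    have h2 : (β ^ (2 * s - 1)) ^ n ≤ (β ^ s) ^ n := by
      gcongr
      linarith
    simp only [hr, hL, if_true]
    linarith
  have hβs : 1 ≤ β ^ s := Real.one_le_rpow hβ hs0.le
  have hα2 : α ^ (2 * s - 1) ≤ θ :=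
    (le_mul_of_one_le_right (by positivity) hβs).trans hαβθ
  have hβL (n : ℕ) : (L true n : ℝ) ^ s ≤ 4 * (β ^ s) ^ n := by
    have := natCeil_add_two_rpow_le hβ (e := s) hs0.le hs1 n
    simpa only [hL, if_true] using this
  have hαL (n : ℕ) : (L false n : ℝ) ^ s ≤ 4 * (α ^ s) ^ (n + 1) := by
    have := natCeil_add_two_rpow_le hα (e := s) hs0.le hs1 (n + 1)
    simpa only [hL, Bool.false_eq_true, if_false] using this
  obtain ⟨κ, P, hPprod, hPC, hfirst, hsecond, hinf⟩ := exists_lurothSchedule (S := S) (θ := θ)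
    (C := 256) (u := r false) (v := r true) hθ hS (by norm_num) (hr0 _) (hr0 _)
    (fun m => by
      have := pow_le_pow_left₀ (by positivity) hα2 (m + 1)
      have h0 : 0 ≤ θ ^ (m + 1) := by positivity
      linarith [hαr m])
    (fun m => by
      calc r false m * r true (m + 1)
          ≤ (16 * (α ^ (2 * s - 1)) ^ (m + 1)) * (16 * (β ^ s) ^ (m + 1)) :=
            mul_le_mul (hαr m) (hβr _) (hr0 _ _) (by positivity)
        _ = 256 * (α ^ (2 * s - 1) * β ^ s) ^ (m + 1) := by rw [mul_pow]; ring
        _ ≤ _ := by gcongr)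
  set D : ℕ → Finset ℕ := fun n =>
    (κ n).elim (Finset.Ico 2 M) fun b => Finset.Ico (L b n) (2 * L b n) with hD
  set p : ℕ → ℕ → ℝ := fun n => (κ n).elim
    (fun d => ((d : ℝ) * ((d : ℝ) - 1)) ^ (-s) / S) fun b _ => 1 / (L b n : ℝ) with hp
  have hDnone (n : ℕ) (h : κ n = none) : D n = Finset.Ico 2 M := by simp [hD, h]
  have hDsome (n : ℕ) (b : Bool) (h : κ n = some b) : D n = Finset.Ico (L b n) (2 * L b n) := by
    simp [hD, h]
  have hpnone (n : ℕ) (h : κ n = none) :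
      p n = fun d : ℕ => ((d : ℝ) * ((d : ℝ) - 1)) ^ (-s) / S := by simp [hp, h]
  have hpsome (n : ℕ) (b : Bool) (h : κ n = some b) : p n = fun _ => 1 / (L b n : ℝ) := by
    simp [hp, h]
  have hD2 (n : ℕ) : ∀ d ∈ D n, 2 ≤ d := by
    intro d hd
    rcases h : κ n with _ | b
    · rw [hDnone n h] at hd
      exact (Finset.mem_Ico.1 hd).1
    · rw [hDsome n b h] at hd
      have := (Finset.mem_Ico.1 hd).1
      have := hL3 b n
      omega
  have hdd {d : ℕ} (hd : 2 ≤ d) : (0 : ℝ) < (d : ℝ) * (d - 1) := by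
    have hd' : (2 : ℝ) ≤ d := by exact_mod_cast hd
    nlinarith
  have hp0 (n : ℕ) : ∀ d ∈ D n, 0 ≤ p n d := by
    intro d hd
    have := hdd (hD2 n d hd)
    rcases h : κ n with _ | b
    · rw [hpnone n h]; positivity
    · rw [hpsome n b h]; positivity
  have hp1 (n : ℕ) : ∑ d ∈ D n, p n d = 1 := by
    rcases h : κ n with _ | b
    · rw [hpnone n h, hDnone n h, ← Finset.sum_div, ← hSdef, div_self hS0.ne']
    · rw [hpsome n b h, hDsome n b h, Finset.sum_const, Nat.card_Ico, nsmul_eq_mul,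
        show 2 * L b n - L b n = L b n by omega, mul_one_div_cancel (hLpos b n).ne']
  have hprob (n : ℕ) : IsProbabilityMeasure (finsetMeasure (D n) (p n)) :=
    isProbabilityMeasure_finsetMeasure (hp0 n) (hp1 n)
  have hmain := le_dimH_image_lurothPoint (μ := fun n => finsetMeasure (D n) (p n)) (D := D)
    (ρ := fun i => (κ i).elim S⁻¹ fun b => if b then r true i else r false i) (s := s) (M := M)
    (C := 512 * (M : ℝ) ^ 2) hs0 hM (by positivity) hD2 (fun n => finsetMeasure_compl (hp0 n))
    (fun n => by
      rcases h : κ n with _ | b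
      · right
        intro d hd
        rw [hDnone n h] at hd
        exact (Finset.mem_Ico.1 hd).2.le
      · left
        intro d hd
        rw [hDsome n b h] at hd
        exact (hL3 b n).trans (Finset.mem_Ico.1 hd).1)
    (fun n d hd => by
      rw [finsetMeasure_real_singleton (hp0 n) hd]
      have hd0 := hdd (hD2 n d hd)
      rcases h : κ n with _ | b
      · rw [hpnone n h]
        simp only [Option.elim_none]
        rw [div_mul_eq_mul_div, ← Real.rpow_add hd0, neg_add_cancel, Real.rpow_zero, one_div]
      · have he : (if b = true then r true n else r false n) = r b n := by cases b <;> rfl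
        rw [hpsome n b h]
        simp only [Option.elim_some]
        rw [he]
        rw [hDsome n b h, Finset.mem_Ico] at hd
        have hd1 : (L b n : ℝ) ≤ d := by exact_mod_cast hd.1
        have hd2 : (d : ℝ) ≤ 2 * L b n := by exact_mod_cast hd.2.le
        have hLp := hLpos b n
        calc 1 / (L b n : ℝ) * ((d : ℝ) * (d - 1)) ^ s
            ≤ 1 / (L b n : ℝ) * (4 * (L b n : ℝ) ^ (2 : ℝ)) ^ s := by
              rw [Real.rpow_two]
              have hle : (d : ℝ) * (d - 1) ≤ 4 * (L b n : ℝ) ^ 2 := by nlinarith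
              gcongr
          _ = 4 ^ s * (L b n : ℝ) ^ (2 * s - 1) := by
              rw [Real.mul_rpow (by norm_num) (by positivity), ← Real.rpow_mul hLp.le,
                Real.rpow_sub_one hLp.ne']
              ring
          _ ≤ 4 ^ (1 : ℝ) * (L b n : ℝ) ^ (2 * s - 1) := by
              gcongr
              norm_num
          _ = r b n := by rw [Real.rpow_one])
    (fun n => by
      rw [← hPprod]
      have hM1 : (1 : ℝ) ≤ (M : ℝ) ^ 2 := one_le_pow₀ (by exact_mod_cast (by omega : 1 ≤ M))
      linarith [(hPC n).2])
    (fun n a ha b hb hab => by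
      rw [← hPprod]
      have ha2 := hD2 n a ha
      have hM1 : (1 : ℝ) ≤ (M : ℝ) ^ 2 := one_le_pow₀ (by exact_mod_cast (by omega : 1 ≤ M))
      have hab' : (a : ℝ) + 1 ≤ b := by exact_mod_cast hab
      have ha0 : (0 : ℝ) < a := by positivity
      have hb0 : (0 : ℝ) < b := by linarith
      have hq : 0 ≤ (((b : ℝ) - a) / (a * b)) ^ s :=
        Real.rpow_nonneg (div_nonneg (by linarith) (by positivity)) _
      rcases h : κ n with _ | c
      · rw [hDnone n h, Finset.mem_Ico] at ha hb
        have haM : (a : ℝ) ≤ M := by exact_mod_cast ha.2.le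
        have hbM : (b : ℝ) ≤ M := by exact_mod_cast hb.2.le
        -- At a free position digits are at most M, so the spread is bounded below and the trivial
        -- mass bound suffices.
        have h1 : 1 / (M : ℝ) ^ 2 ≤ (((b : ℝ) - a) / (a * b)) ^ s := by
          calc 1 / (M : ℝ) ^ 2 ≤ (1 / (M : ℝ) ^ 2) ^ s :=
                Real.self_le_rpow_of_le_one (by positivity) (by
                  rw [div_le_one (by positivity)]; exact hM1) hs1
            _ ≤ _ := by
                refine Real.rpow_le_rpow (by positivity) ?_ hs0.le
                rw [sq]
                gcongr <;> linarith
        have hμ1 : (finsetMeasure (D n) (p n)).real (Icc a b) ≤ 1 := measureReal_le_one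
        calc P n * (finsetMeasure (D n) (p n)).real (Icc a b) ≤ 256 * 1 :=
              mul_le_mul (hPC n).2 hμ1 measureReal_nonneg (by norm_num)
          _ ≤ 512 * (M : ℝ) ^ 2 * (1 / (M : ℝ) ^ 2) := by
              rw [mul_assoc, mul_one_div_cancel (by positivity)]
              norm_num
          _ ≤ _ := by gcongr
      · rw [hDsome n c h] at ha hb
        -- A whole block has spread of order 1/L, so P must be O(L^(-s)); the opening threshold
        -- provides this for both members of the pair.
        have hPL : P n * (L c n : ℝ) ^ s ≤ 64 := by
          cases c
          · have h1 := (hfirst n h).1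
            calc P n * (L false n : ℝ) ^ s ≤ (θ ^ (n + 1))⁻¹ * (4 * (α ^ s) ^ (n + 1)) :=
                  mul_le_mul h1 (hαL n) (by positivity) (by positivity)
              _ ≤ (θ ^ (n + 1))⁻¹ * (4 * θ ^ (n + 1)) := by gcongr
              _ = 4 := by field_simp
              _ ≤ 64 := by norm_num
          · obtain ⟨m, rfl, hm⟩ := hsecond n h
            have h1 := (hfirst m hm).1
            have h2 : P (m + 1) = P m * r false m := by
              rw [hPprod, hPprod, Finset.prod_range_succ, hm]
              simp
            calc P (m + 1) * (L true (m + 1) : ℝ) ^ s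
                ≤ (θ ^ (m + 1))⁻¹ * (16 * (α ^ (2 * s - 1)) ^ (m + 1)) *
                    (4 * (β ^ s) ^ (m + 1)) := by
                  rw [h2]
                  exact mul_le_mul (mul_le_mul h1 (hαr m) (hr0 _ _) (by positivity)) (hβL _)
                    (by positivity) (by positivity)
              _ = (θ ^ (m + 1))⁻¹ * (64 * (α ^ (2 * s - 1) * β ^ s) ^ (m + 1)) := by
                  rw [mul_pow]; ring
              _ ≤ (θ ^ (m + 1))⁻¹ * (64 * θ ^ (m + 1)) := by gcongr
              _ = 64 := by field_simp
        calc P n * (finsetMeasure (D n) (p n)).real (Icc a b)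
            ≤ P n * (2 * ((b : ℝ) - a) * (1 / L c n)) := by
              rw [hpsome n c h]
              exact mul_le_mul_of_nonneg_left (finsetMeasure_const_real_Icc_le
                (by positivity) hab) (hPC n).1
          _ ≤ 8 * 64 * (((b : ℝ) - a) / (a * b)) ^ s :=
              mass_le_of_mem_Ico hs0.le hs1 (hPC n).1 hPL ha hb hab
          _ ≤ _ := by
              refine mul_le_mul_of_nonneg_right ?_ hq
              linarith)
  refine hmain.trans (dimH_mono ?_)
  rintro _ ⟨w, hw, rfl⟩
  have hw2 : ∀ i, 2 ≤ w i := fun i => hD2 i _ (hw i)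
  refine ⟨lurothPoint_mem hw2, (hinf.image (add_left_injective 1).injOn).mono ?_⟩
  rintro _ ⟨n, hn, rfl⟩
  refine ⟨Nat.le_add_left 1 n, ?_⟩
  rw [lurothDigit_lurothPoint hw2, lurothDigit_lurothPoint hw2]
  have h1 : α ^ (n + 1) ≤ w n := by
    have := hw n
    rw [hDsome n false hn, Finset.mem_Ico] at this
    calc α ^ (n + 1) ≤ (⌈α ^ (n + 1)⌉₊ : ℝ) := Nat.le_ceil _
      _ ≤ w n := by
        have h := this.1
        simp only [hL, Bool.false_eq_true, if_false] at h
        exact_mod_cast (by omega : ⌈α ^ (n + 1)⌉₊ ≤ w n)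
  have h2 : β ^ (n + 1) ≤ w (n + 1) := by
    have := hw (n + 1)
    rw [hDsome (n + 1) true (hfirst n hn).2, Finset.mem_Ico] at this
    calc β ^ (n + 1) ≤ (⌈β ^ (n + 1)⌉₊ : ℝ) := Nat.le_ceil _
      _ ≤ w (n + 1) := by
        have h := this.1
        simp only [hL, if_true] at h
        exact_mod_cast (by omega : ⌈β ^ (n + 1)⌉₊ ≤ w (n + 1))
  have hpow {x : ℝ} (hx : 0 ≤ x) (t : ℝ) : (x ^ (n + 1)) ^ t = (x ^ t) ^ (n + 1) := by
    rw [← Real.rpow_natCast x, ← Real.rpow_mul hx, ← Real.rpow_natCast (x ^ t),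
      ← Real.rpow_mul hx, mul_comm]
  calc B ^ (n + 1) = (α ^ (n + 1)) ^ t₀ * (β ^ (n + 1)) ^ t₁ := by
        rw [← hαβ, mul_pow, hpow hα0.le, hpow hβ0.le]
    _ ≤ _ := by gcongr

/-- Take θ = B^f(s): by hypothesis finitely many digits already give a sum above θ. -/
theorem le_dimH_lurothProductSet (ht₀ : 0 < t₀) (ht₁ : 0 < t₁) (hB : 1 < B) (hs : 1 / 2 < s)
    (hs1 : s ≤ 1) (h : B ^ lurothExponent t₀ t₁ s < lurothZeta s) :
    ENNReal.ofReal s ≤ dimH (lurothProductSet t₀ t₁ B) := by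
  have hs0 : 0 < s := by linarith
  obtain ⟨α, β, hα, hβ, hαβ, h1, h2⟩ := exists_growth_rates ht₀ ht₁ hB hs0 hs1
  obtain ⟨n, hn⟩ := ((summable_lurothTerm hs).hasSum.tendsto_sum_nat.eventually_const_lt h).exists
  refine le_dimH_of_truncated_sum (M := n + 2) hs hs1 ht₀ ht₁ hα hβ hαβ
    (Real.one_le_rpow hB.le (lurothExponent_pos ht₀ ht₁ hs0).le) h1 h2 (by omega) ?_
  refine hn.trans_eq ?_
  rw [Finset.sum_Ico_eq_sum_range, Nat.add_sub_cancel]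
  refine Finset.sum_congr rfl fun k _ => ?_
  rw [lurothTerm_eq_rpow]
  push_cast
  congr 1
  ring

end Construction

/-! ### Conclusion. -/

theorem theorem5p1 (t₀ t₁ : ℝ) (ht₀ : 0 < t₀) (ht₁ : 0 < t₁) :
    ∃ s₀ : ℝ → ℝ,
      (∀ B : ℝ, 1 < B →
        IsLurothRoot t₀ t₁ B (s₀ B) ∧
        (∀ s : ℝ, IsLurothRoot t₀ t₁ B s → s = s₀ B) ∧
        dimH (lurothProductSet t₀ t₁ B) = ENNReal.ofReal (s₀ B)) ∧
      ContinuousOn s₀ (Set.Ioi 1) := by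
  have hex (B : ℝ) : ∃ s, 1 < B → IsLurothRoot t₀ t₁ B s := by
    by_cases hB : 1 < B
    · obtain ⟨s, hs⟩ := exists_isLurothRoot ht₀ ht₁ hB
      exact ⟨s, fun _ => hs⟩
    · exact ⟨0, fun h => absurd h hB⟩
  choose s₀ hroot using hex
  refine ⟨s₀, fun B hB => ⟨hroot B hB, fun s hs => hs.unique ht₀ ht₁ hB (hroot B hB), ?_⟩,
    continuousOn_of_isLurothRoot ht₀ ht₁ hroot⟩
  have hr := hroot B hB
  have hhalf := hr.half_lt hB
  have hone := hr.lt_one ht₀ ht₁ hB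
  -- The one-sided bounds hold for every s strictly above, respectively strictly below, the root and
  -- near it; both pass to the limit.
  apply le_antisymm
  · refine ge_of_tendsto (x := 𝓝[>] (s₀ B)) (f := fun s => ENNReal.ofReal s)
      ((ENNReal.continuous_ofReal.tendsto _).mono_left nhdsWithin_le_nhds) ?_
    filter_upwards [Ioo_mem_nhdsGT hone] with s hs
    exact dimH_lurothProductSet_le ht₀ ht₁ hB (hhalf.trans hs.1) hs.2.le
      (hr.lurothZeta_lt_rpow ht₀ ht₁ hB hs.1 hs.2.le)
  · refine le_of_tendsto (x := 𝓝[<] (s₀ B)) (f := fun s => ENNReal.ofReal s)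
      ((ENNReal.continuous_ofReal.tendsto _).mono_left nhdsWithin_le_nhds) ?_
    filter_upwards [Ioo_mem_nhdsLT hhalf] with s hs
    exact le_dimH_lurothProductSet ht₀ ht₁ hB hs.1 (hs.2.trans hone).le
      (hr.rpow_lt_lurothZeta ht₀ ht₁ hB hs.1 hs.2)
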